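/- Let $s_0<s_1$, let $g\in\mathcal C^2([s_0,s_1],\mathbb R)$, and let $S\subset\mathbb R^3$ be, up to a rigid motion, the compact surface of revolution $$S=\{(g(s)\cos\theta,\ g(s)\sin\theta,\ s):\ s\in[s_0,s_1],\ \theta\in[0,2\pi]\}$$ (a rotationally invariant surface, $\mathcal C^2$ up to the boundary, whose profile curve is a graph over the axis of rotation). Assume that $\bar S$ does not meet the axis of rotation, i.e. $g$ has no zero. For $w\in W^{1,2}(S,\mathbb R^3)$ let $\mathrm{sym}\,\nabla w(x)$ be the symmetric bilinear form $(\tau,\eta)\mapsto\frac12\big(\partial_\tau w(x)\cdot\eta+\partial_\eta w(x)\cdot\tau\big)$ on the tangent space $T_xS$, and for a matrix field $A:S\to\mathbb R^{3\times3}$ let $A_{tan}(x)$ be the bilinear form $(\tau,\eta)\mapsto (A(x)\tau)\cdot\eta$ on $T_xS$. Let $$\mathcal B=\Big\{\lim_{n\to\infty}\mathrm{sym}\,\nabla w_n\ \text{ in } L^2(S):\ w_n\in W^{1,2}(S,\mathbb R^3)\Big\}.$$ Then $\mathcal B$ is the space of all symmetric tangential matrix fields of class $L^2$ on $S$: $$\mathcal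 B=\{B_{tan}\in L^2(S,\mathbb R^{2\times2}):\ B_{tan}^T=B_{tan}\}.$$ In particular $S$ is approximately robust: for every $V\in W^{2,2}(S,\mathbb R^3)$ and every $A\in W^{1,2}(S,\mathbb R^{3\times3})$ with $A(x)^T=-A(x)$ and $\partial_\tau V(x)=A(x)\tau$ for all $\tau\in T_xS$ and a.e. $x\in S$, one has $(A^2)_{tan}\in\mathcal B$. -/

import Mathlib

open MeasureTheory Filter Topology Set
open scoped ENNReal ContDiff InnerProductSpace

noncomputable section

namespace Shell

/-- Euclidean three-space. -/
abbrev E3 : Type := EuclideanSpace ℝ (Fin 3)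

/-! ### Geometry of a surface `S ⊆ ℝ³` -/

/-- The area measure of `S`: two-dimensional Hausdorff measure, normalized so as to agree with
Lebesgue measure on planes, restricted to `S`. -/
def area (S : Set E3) : Measure E3 := (Measure.euclideanHausdorffMeasure 2).restrict S

/-- The tangent space `T_x S`, the linear span of the tangent cone of `S` at `x`. -/
def tangentSpaceAt (S : Set E3) (x : E3) : Submodule ℝ E3 :=
  Submodule.span ℝ (tangentConeAt ℝ S x)

/-- The orthogonal projection of `ℝ³` onto `T_x S`. -/
def tangentProj (S : Set E3) (x : E3) : E3 →L[ℝ] E3 := (tangentSpaceAt S x).starProjection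

/-- The tangential minor `A_tan` of a matrix field `A`: the bilinear form
`(τ, η) ↦ (A(x) τ) · η` on `T_x S`, encoded as the operator `P A(x) P` of `ℝ³`, where `P` is the
orthogonal projection onto `T_x S`. -/
def tan (S : Set E3) (A : E3 → E3 →L[ℝ] E3) (x : E3) : E3 →L[ℝ] E3 :=
  tangentProj S x ∘L A x ∘L tangentProj S x

/-- A local `C²` parametrization of `S`: an injective `C²` immersion of an open set `U` of the
plane into `S`. (When `S` is an embedded surface, possibly with boundary, such a map is
automatically a homeomorphism onto a relatively open subset of `S` that misses the boundary.) -/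
structure IsLocalParam (S : Set E3) (U : Set (ℝ × ℝ)) (ψ : ℝ × ℝ → E3) : Prop where
  isOpen : IsOpen U
  contDiffOn : ContDiffOn ℝ 2 ψ U
  injOn : InjOn ψ U
  immersion : ∀ y ∈ U, Function.Injective (fderiv ℝ ψ y)
  mapsTo : MapsTo ψ U S

/-! ### Sobolev spaces on `S` -/

variable {F : Type*} [NormedAddCommGroup F] [NormedSpace ℝ F]

/-- `w ∈ W^{1,2}(S, F)`, with weak gradient represented by `G ∈ L²`: in every local
parametrization `ψ` the weak derivative of `w ∘ ψ` in the direction `v` is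
`G (ψ y) (Dψ(y) v)`. Only the restriction of `G x` to `T_x S` is determined by `w`:
`∂_τ w (x) = G x τ` for `τ ∈ T_x S`. -/
structure HasWeakGradient (S : Set E3) (w : E3 → F) (G : E3 → E3 →L[ℝ] F) : Prop where
  memLp : MemLp w 2 (area S)
  memLp_grad : MemLp G 2 (area S)
  weak : ∀ (U : Set (ℝ × ℝ)) (ψ : ℝ × ℝ → E3), IsLocalParam S U ψ →
    ∀ φ : ℝ × ℝ → ℝ, ContDiff ℝ ∞ φ → HasCompactSupport φ → tsupport φ ⊆ U →
      ∀ v : ℝ × ℝ,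
        ∫ y, (fderiv ℝ φ y v) • w (ψ y) = - ∫ y, φ y • G (ψ y) (fderiv ℝ ψ y v)

/-- Membership in `W^{1,2}(S, F)`. -/
def MemW12 (S : Set E3) (w : E3 → F) : Prop :=
  ∃ G : E3 → E3 →L[ℝ] F, HasWeakGradient S w G

/-- Membership in `W^{2,2}(S, F)`: the tangential gradient (the representative of the weak gradient
that vanishes on normal vectors) is itself of class `W^{1,2}`. -/
def MemW22 (S : Set E3) (w : E3 → F) : Prop :=
  ∃ G : E3 → E3 →L[ℝ] F, HasWeakGradient S w G ∧
    (∀ᵐ x ∂area S, G x ∘L tangentProj S x = G x) ∧ MemW12 S G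

/-! ### Finite strains and approximate robustness -/

/-- `sym ∇w` for a vector field `w` on `S` with weak gradient `G`: the bilinear form
`(τ, η) ↦ ½ (∂_τ w · η + ∂_η w · τ)` on `T_x S`. -/
def symGrad (S : Set E3) (G : E3 → E3 →L[ℝ] E3) (x : E3) : E3 →L[ℝ] E3 :=
  (1 / 2 : ℝ) • (tan S G x + ContinuousLinearMap.adjoint (tan S G x))

/-- The `L²` classes of the fields `sym ∇w`, `w ∈ W^{1,2}(S, ℝ³)`. -/
def strains (S : Set E3) : Set (Lp (E3 →L[ℝ] E3) 2 (area S)) :=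
  {E | ∃ (w : E3 → E3) (G : E3 → E3 →L[ℝ] E3), HasWeakGradient S w G ∧ E =ᵐ[area S] symGrad S G}

/-- The space `𝓑` of finite strains: all `L²` limits of sequences of fields `sym ∇wₙ` with
`wₙ ∈ W^{1,2}(S, ℝ³)`. -/
def finiteStrains (S : Set E3) : Set (Lp (E3 →L[ℝ] E3) 2 (area S)) :=
  {B | ∃ E : ℕ → Lp (E3 →L[ℝ] E3) 2 (area S), (∀ n, E n ∈ strains S) ∧ Tendsto E atTop (𝓝 B)}

/-- All symmetric tangential matrix fields of class `L²` on `S`. -/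
def symTanFields (S : Set E3) : Set (Lp (E3 →L[ℝ] E3) 2 (area S)) :=
  {B | ∀ᵐ x ∂area S, tan S B x = B x ∧ ContinuousLinearMap.adjoint (B x) = B x}

/-- `S` is approximately robust: `(A²)_tan ∈ 𝓑` whenever `V ∈ W^{2,2}(S, ℝ³)` and
`A ∈ W^{1,2}(S, ℝ^{3×3})` are such that `A` is skew-symmetric and `∂_τ V = A τ` for all
tangent vectors `τ`, almost everywhere on `S`. -/
def ApproximatelyRobust (S : Set E3) : Prop :=
  ∀ (V : E3 → E3) (A : E3 → E3 →L[ℝ] E3), MemW22 S V → MemW12 S A →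
    (∃ G : E3 → E3 →L[ℝ] E3, HasWeakGradient S V G ∧
      ∀ᵐ x ∂area S, ∀ τ ∈ tangentSpaceAt S x, G x τ = A x τ) →
    (∀ᵐ x ∂area S, ContinuousLinearMap.adjoint (A x) = - A x) →
    ∃ B ∈ finiteStrains S, B =ᵐ[area S] tan S (fun x => A x ∘L A x)

/-! ### Surfaces of revolution -/

/-- The axis of rotation: the image of the third coordinate axis under the rigid motion `Φ`. -/
def rotationAxis (Φ : E3 ≃ᵃⁱ[ℝ] E3) : Set E3 :=
  {p | ∃ s : ℝ, p = Φ !₂[0, 0, s]}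

/-- The compact surface of revolution with profile `g` over `[s₀, s₁]`: the image, under the rigid
motion `Φ`, of the set of all `g(s) (cos θ, sin θ, 0) + s e₃`. -/
def surfaceOfRevolution (Φ : E3 ≃ᵃⁱ[ℝ] E3) (s₀ s₁ : ℝ) (g : ℝ → ℝ) : Set E3 :=
  {p | ∃ s ∈ Icc s₀ s₁, ∃ θ : ℝ, p = Φ !₂[g s * Real.cos θ, g s * Real.sin θ, s]}

end Shell

end

/-! Strains are symmetric tangential fields and these form a closed subset of L², so the point is
density. In a Fourier mode, with the frame (e_r, e_θ, e_z), the displacement a(s) cos(kθ+φ) e_r +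
b(s) sin(kθ+φ) e_θ + c(s) cos(kθ+φ) e_z has strain components p₁ cos, p₂ sin, p₃ cos along meridians
and parallels exactly when g'a' + c' = p₁, g b' - g'(k a + b) - k c = 2 p₂, g (a + k b) = p₃. Off
the axis g ≠ 0, so the third equation is algebraic and gives a = p₃/g - k b. What remains is a
linear first-order system for (b, c). It is solvable on the whole interval, since no boundary
condition is imposed on the displacement. Hence every mode with C¹ coefficients is exactly a strain
(`IsProfile.isStrain_mode`). By Stone–Weierstrass, sums of modes are dense in L²
(`IsProfile.exists_mem_trigFields_eLpNorm_sub_le`), and a symmetric tangential field is controlled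
by its three components (`IsProfile.norm_le_of_tangential`).

For robustness it remains to see that (A²)_tan is a symmetric field of class L². Symmetry follows
from skewness of A, and A² ∈ L² from the two-dimensional embedding of W^{1,2} into L⁴
(`IsProfile.memLp_four`). The latter is proved on the parameter rectangle by Gagliardo's argument: u
is bounded by a function of s alone and by a function of θ alone, both square integrable.

Area and Lebesgue measure in the chart are only compared up to constants, by Lipschitz bounds on the
parametrization and its inverse; no area formula is needed. -/

noncomputable section

namespace Shell

/-! ### One-variable calculus -/

/-- A function that is `C¹` up to the boundary of a compact interval extends to a `C¹` function on
the line. -/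
theorem exists_contDiff_extension {E : Type*} [NormedAddCommGroup E] [NormedSpace ℝ E]
    [CompleteSpace E] {a b : ℝ} (hab : a ≤ b) {f f' : ℝ → E}
    (hf : ∀ t ∈ Icc a b, HasDerivWithinAt f (f' t) (Icc a b) t) (hf' : ContinuousOn f' (Icc a b)) :
    ∃ F : ℝ → E, ContDiff ℝ 1 F ∧ ∀ t ∈ Icc a b, F t = f t ∧ deriv F t = f' t := by
  -- Freezing f' at its endpoint values outside the interval keeps it continuous; F is its integral.
  set k : ℝ → E := IccExtend hab ((Icc a b).domRestrict f') with hk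
  have hkc : Continuous k := hf'.domRestrict.Icc_extend'
  have hkeq : ∀ t ∈ Icc a b, k t = f' t := fun t ht => by
    rw [hk, IccExtend_of_mem hab _ ht]; rfl
  have hd : ∀ t, HasDerivAt (fun t => f a + ∫ u in a..t, k u) (k t) t := fun t =>
    (intervalIntegral.integral_hasDerivAt_right (hkc.intervalIntegrable _ _)
      hkc.aestronglyMeasurable.stronglyMeasurableAtFilter hkc.continuousAt).const_add _
  have hderiv : deriv (fun t => f a + ∫ u in a..t, k u) = k := funext fun t => (hd t).deriv
  refine ⟨fun t => f a + ∫ u in a..t, k u, ?_, fun t ht => ⟨?_, ?_⟩⟩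
  · rw [contDiff_one_iff_deriv, hderiv]
    exact ⟨fun t => (hd t).differentiableAt, hkc⟩
  -- F - f has zero right derivative and vanishes at a.
  · have hz := constant_of_has_deriv_right_zero (f := fun t => (f a + ∫ u in a..t, k u) - f t)
      (a := a) (b := b) ?_ ?_ t ht
    · simpa [sub_eq_zero] using hz
    · refine ContinuousOn.sub (fun t _ => (hd t).continuousAt.continuousWithinAt) ?_
      exact fun t ht => (hf t ht).continuousWithinAt
    · intro t ht
      have h1 : HasDerivWithinAt f (f' t) (Ici t) t := by
        refine (hf t ⟨ht.1, ht.2.le⟩).mono_of_mem_nhdsWithin ?_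
        exact mem_of_superset (Icc_mem_nhdsGE ht.2) (Icc_subset_Icc_left ht.1)
      have h2 := (hd t).hasDerivWithinAt (s := Ici t)
      have h3 := h2.sub h1
      rw [hkeq t ⟨ht.1, ht.2.le⟩, sub_self] at h3
      exact h3
  · rw [hderiv, hkeq t ht]

/-- Coordinatewise truncation of the plane at height `R`. -/
def clamp (R : ℝ) (x : ℝ × ℝ) : ℝ × ℝ := (max (-R) (min R x.1), max (-R) (min R x.2))

theorem lipschitzWith_clamp (R : ℝ) : LipschitzWith 1 (clamp R) := by
  have h : LipschitzWith 1 fun t : ℝ => max (-R) (min R t) :=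
    (LipschitzWith.id.const_min R).const_max (-R)
  have h1 : LipschitzWith 1 fun x : ℝ × ℝ => max (-R) (min R x.1) := by
    simpa [Function.comp_def] using h.comp LipschitzWith.prod_fst
  have h2 : LipschitzWith 1 fun x : ℝ × ℝ => max (-R) (min R x.2) := by
    simpa [Function.comp_def] using h.comp LipschitzWith.prod_snd
  have h3 := h1.prodMk h2
  rw [max_self] at h3
  exact h3

theorem abs_max_min_le {R : ℝ} (hR : 0 ≤ R) (t : ℝ) :
    |max (-R) (min R t)| ≤ R ∧ |max (-R) (min R t)| ≤ |t| := by
  refine ⟨abs_le.2 ⟨le_max_left _ _, max_le (by linarith) (min_le_left _ _)⟩, abs_le.2 ⟨?_, ?_⟩⟩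
  · rcases le_total R t with h | h
    · rw [min_eq_left h, max_eq_right (by linarith)]; linarith [abs_nonneg t]
    · rw [min_eq_right h]; exact (neg_abs_le t).trans (le_max_right _ _)
  · exact max_le (by linarith [abs_nonneg t]) ((min_le_right _ _).trans (le_abs_self t))

theorem norm_clamp_le {R : ℝ} (hR : 0 ≤ R) (x : ℝ × ℝ) : ‖clamp R x‖ ≤ R :=
  norm_prod_le_iff.2 ⟨(abs_max_min_le hR _).1, (abs_max_min_le hR _).1⟩

theorem norm_clamp_le_norm {R : ℝ} (hR : 0 ≤ R) (x : ℝ × ℝ) : ‖clamp R x‖ ≤ ‖x‖ :=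
  norm_prod_le_iff.2 ⟨(abs_max_min_le hR _).2.trans (norm_fst_le x),
    (abs_max_min_le hR _).2.trans (norm_snd_le x)⟩

theorem clamp_of_norm_le {R : ℝ} {x : ℝ × ℝ} (hx : ‖x‖ ≤ R) : clamp R x = x := by
  have h1 := abs_le.1 ((norm_fst_le x).trans hx)
  have h2 := abs_le.1 ((norm_snd_le x).trans hx)
  ext <;> simp [clamp, h1.1, h1.2, h2.1, h2.2]

/-- Linear systems with continuous coefficients are solvable on compact intervals. -/
theorem exists_solution_linear_system {a b : ℝ} (hab : a ≤ b)
    {A : ℝ → (ℝ × ℝ) →L[ℝ] ℝ × ℝ} {h : ℝ → ℝ × ℝ} (hA : Continuous A) (hh : Continuous h) :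
    ∃ x : ℝ → ℝ × ℝ, ∀ t ∈ Icc a b, HasDerivWithinAt x (A t (x t) + h t) (Icc a b) t := by
  obtain ⟨K, hK⟩ := isCompact_Icc.exists_bound_of_continuousOn (s := Icc a b) hA.continuousOn
  obtain ⟨M, hM⟩ := isCompact_Icc.exists_bound_of_continuousOn (s := Icc a b) hh.continuousOn
  have hK0 : 0 ≤ K := (norm_nonneg _).trans (hK a ⟨le_rfl, hab⟩)
  have hM0 : 0 ≤ M := (norm_nonneg _).trans (hM a ⟨le_rfl, hab⟩)
  -- An a priori bound for any solution that starts at 0.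
  set R := gronwallBound 0 K M (b - a) with hR
  have hmono : Monotone (gronwallBound 0 K M) := gronwallBound_mono le_rfl hM0 hK0
  have hR0 : 0 ≤ R := by
    have := hmono (sub_nonneg.2 hab)
    rwa [gronwallBound_x0] at this
  have hL0 : 0 ≤ K * R + M := by positivity
  -- The truncated field is bounded by K R + M everywhere, so Picard–Lindelöf covers the whole
  -- interval at once. Grönwall then keeps the solution below R, where the truncation does nothing.
  have hP : IsPicardLindelof (fun t x => A t (clamp R x) + h t) (tmin := a) (tmax := b)
      ⟨a, le_rfl, hab⟩ (0 : ℝ × ℝ) ((K * R + M) * (b - a)).toNNReal 0 (K * R + M).toNNReal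
      K.toNNReal := by
    refine ⟨fun t ht => ?_, fun x _ => ?_, fun t ht x _ => ?_, ?_⟩
    · refine LipschitzWith.lipschitzOnWith (LipschitzWith.of_dist_le_mul fun x y => ?_)
      rw [dist_add_right, dist_eq_norm, ← map_sub, Real.coe_toNNReal _ hK0]
      refine ((A t).le_of_opNorm_le (hK t ht) _).trans ?_
      gcongr
      simpa [dist_eq_norm] using (lipschitzWith_clamp R).dist_le_mul x y
    · fun_prop
    · rw [Real.coe_toNNReal _ hL0]
      refine (norm_add_le _ _).trans (add_le_add ?_ (hM t ht))
      refine ((A t).le_of_opNorm_le (hK t ht) _).trans ?_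
      gcongr
      exact norm_clamp_le hR0 x
    · have : 0 ≤ b - a := sub_nonneg.2 hab
      simp [Real.coe_toNNReal _ hL0, Real.coe_toNNReal _ (mul_nonneg hL0 this), this]
  obtain ⟨x, hx0, hx⟩ := hP.exists_eq_forall_mem_Icc_hasDerivWithinAt₀
  have hbound : ∀ t ∈ Icc a b, ‖x t‖ ≤ R := by
    intro t ht
    refine (norm_le_gronwallBound_of_norm_deriv_right_le (f := x) (δ := 0) (K := K) (ε := M)
      (f' := fun t => A t (clamp R (x t)) + h t) (a := a) (b := b) ?_ ?_ ?_ ?_ t ht).trans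
      (hmono (by linarith [ht.2]))
    · exact fun t ht => (hx t ht).continuousWithinAt
    · intro t ht
      exact (hx t ⟨ht.1, ht.2.le⟩).mono_of_mem_nhdsWithin
        (mem_of_superset (Icc_mem_nhdsGE ht.2) (Icc_subset_Icc_left ht.1))
    · simpa using hx0
    · intro t ht
      have ht' : t ∈ Icc a b := ⟨ht.1, ht.2.le⟩
      refine (norm_add_le _ _).trans (add_le_add ?_ (hM t ht'))
      refine ((A t).le_of_opNorm_le (hK t ht') _).trans ?_
      gcongr
      exact norm_clamp_le_norm hR0 _
  refine ⟨x, fun t ht => ?_⟩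
  have := hx t ht
  rwa [clamp_of_norm_le (hbound t ht)] at this

/-! ### Weak derivatives on rectangles -/

section Rectangle

variable {F : Type*} [NormedAddCommGroup F] [NormedSpace ℝ F]

/-- Smooth functions with compact support in `U`. -/
structure IsTestFunction (U : Set ℝ) (ζ : ℝ → ℝ) : Prop where
  contDiff : ContDiff ℝ ∞ ζ
  hasCompactSupport : HasCompactSupport ζ
  tsupport_subset : tsupport ζ ⊆ U

theorem IsTestFunction.exists_bound {U : Set ℝ} {ζ : ℝ → ℝ} (h : IsTestFunction U ζ) :
    ∃ C, ∀ t, ‖ζ t‖ ≤ C :=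
  h.contDiff.continuous.bounded_above_of_compact_support h.hasCompactSupport

theorem IsTestFunction.deriv {U : Set ℝ} {ζ : ℝ → ℝ} (h : IsTestFunction U ζ) :
    IsTestFunction U (deriv ζ) where
  contDiff := (contDiff_infty_iff_deriv.1 h.contDiff).2
  hasCompactSupport := h.hasCompactSupport.deriv
  tsupport_subset := tsupport_deriv_subset.trans h.tsupport_subset

/-- An integrable function on a product whose integral over every measurable rectangle vanishes is
zero almost everywhere. -/
theorem ae_eq_zero_of_forall_setIntegral_prod_eq_zero [CompleteSpace F] {α β : Type*} [MeasurableSpace α]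
    [MeasurableSpace β] {μ : Measure (α × β)} {f : α × β → F} (hf : Integrable f μ)
    (h : ∀ s t, MeasurableSet s → MeasurableSet t → ∫ p in s ×ˢ t, f p ∂μ = 0) :
    f =ᵐ[μ] 0 := by
  suffices key : ∀ s, MeasurableSet s → ∫ p in s, f p ∂μ = 0 from
    hf.ae_eq_zero_of_forall_setIntegral_eq_zero fun s hs _ => key s hs
  intro s hs
  induction s, hs using MeasurableSpace.induction_on_inter generateFrom_prod.symm
    isPiSystem_prod with
  | empty => simp
  | basic s hs =>
    obtain ⟨a, ha, b, hb, rfl⟩ := hs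
    exact h a b ha hb
  | compl s hs ih =>
    -- The whole space is itself a rectangle, so complements follow by subtraction.
    have huniv : ∫ p, f p ∂μ = 0 := by
      simpa using h univ univ MeasurableSet.univ MeasurableSet.univ
    have := integral_add_compl hs hf
    rwa [ih, zero_add, huniv] at this
  | iUnion s hd hs ih =>
    rw [integral_iUnion hs hd hf.integrableOn]
    simp [ih]

/-- The fundamental lemma of the calculus of variations, for products of test functions. -/
theorem ae_eq_zero_of_integral_tensor_eq_zero [CompleteSpace F] {I J : Set ℝ} (hI : IsOpen I) (hJ : IsOpen J)
    {f : ℝ × ℝ → F}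
    (hf : Integrable f ((volume.restrict I).prod (volume.restrict J)))
    (h : ∀ χ η, IsTestFunction I χ → IsTestFunction J η →
      ∫ p, (χ p.1 * η p.2) • f p ∂((volume.restrict I).prod (volume.restrict J)) = 0) :
    ∀ᵐ p ∂((volume.restrict I).prod (volume.restrict J)), f p = 0 := by
  set μ := (volume : Measure ℝ).restrict I
  set ν := (volume : Measure ℝ).restrict J
  have hIae : ∀ᵐ x ∂μ, x ∈ I := ae_restrict_mem hI.measurableSet
  have hJae : ∀ᵐ x ∂ν, x ∈ J := ae_restrict_mem hJ.measurableSet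
  refine ae_eq_zero_of_forall_setIntegral_prod_eq_zero hf fun s t hs ht => ?_
  -- integrate against `η` in the second variable
  have hη : ∀ η, IsTestFunction J η → ∀ᵐ x ∂μ, ∫ y, η y • f (x, y) ∂ν = 0 := by
    intro η hη
    obtain ⟨C, hC⟩ := hη.exists_bound
    have hint : Integrable (fun p : ℝ × ℝ => η p.2 • f p) (μ.prod ν) :=
      hf.bdd_smul C (hη.contDiff.continuous.comp continuous_snd).aestronglyMeasurable
        (ae_of_all _ fun p : ℝ × ℝ => hC p.2)
    have h0 := hI.ae_eq_zero_of_integral_contDiff_smul_eq_zero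
      (f := fun x => ∫ y, η y • f (x, y) ∂ν) (μ := μ)
      (hint.integral_prod_left.locallyIntegrable.locallyIntegrableOn _) ?_
    · filter_upwards [h0, hIae] with x hx hxI using hx hxI
    · intro χ h1 h2 h3
      obtain ⟨C', hC'⟩ := (IsTestFunction.mk h1 h2 h3).exists_bound
      have hint' : Integrable (fun p : ℝ × ℝ => χ p.1 • η p.2 • f p) (μ.prod ν) :=
        hint.bdd_smul C' (h1.continuous.comp continuous_fst).aestronglyMeasurable
          (ae_of_all _ fun p : ℝ × ℝ => hC' p.1)
      rw [← h χ η ⟨h1, h2, h3⟩ hη]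
      simp_rw [mul_smul]
      rw [integral_prod _ hint']
      simp_rw [integral_smul]
  -- With s fixed, test in the second variable; after Fubini the inner integral vanishes by `hη`.
  have hs' : ∀ᵐ y ∂ν, ∫ x in s, f (x, y) ∂μ = 0 := by
    have hfs : Integrable f ((μ.restrict s).prod ν) :=
      hf.mono_measure (Measure.prod_mono Measure.restrict_le_self le_rfl)
    have h0 := hJ.ae_eq_zero_of_integral_contDiff_smul_eq_zero
      (f := fun y => ∫ x in s, f (x, y) ∂μ) (μ := ν)
      (hfs.integral_prod_right.locallyIntegrable.locallyIntegrableOn _) ?_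
    · filter_upwards [h0, hJae] with x hx hxI using hx hxI
    · intro η h1 h2 h3
      obtain ⟨C', hC'⟩ := (IsTestFunction.mk h1 h2 h3).exists_bound
      have hint' : Integrable (fun p : ℝ × ℝ => η p.2 • f p) ((μ.restrict s).prod ν) :=
        hfs.bdd_smul C' (h1.continuous.comp continuous_snd).aestronglyMeasurable
          (ae_of_all _ fun p : ℝ × ℝ => hC' p.2)
      calc ∫ y, η y • ∫ x in s, f (x, y) ∂μ ∂ν = ∫ y, ∫ x in s, η y • f (x, y) ∂μ ∂ν := by
            simp_rw [integral_smul]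
        _ = ∫ x in s, ∫ y, η y • f (x, y) ∂ν ∂μ := (integral_integral_swap hint').symm
        _ = 0 := integral_eq_zero_of_ae (ae_restrict_of_ae (hη η ⟨h1, h2, h3⟩))
  have hint : Integrable f ((μ.restrict s).prod (ν.restrict t)) := by
    rw [Measure.prod_restrict]; exact hf.integrableOn
  rw [← Measure.prod_restrict, integral_prod_symm _ hint]
  exact integral_eq_zero_of_ae (ae_restrict_of_ae hs')

/-! ### Primitives of test functions and weak derivatives along lines. -/

theorem exists_Icc_of_isCompact_subset_Ioo {a b : ℝ} (hab : a < b) {K : Set ℝ} (hK : IsCompact K)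
    (hKs : K ⊆ Ioo a b) : ∃ a' b', a < a' ∧ a' ≤ b' ∧ b' < b ∧ K ⊆ Icc a' b' := by
  rcases K.eq_empty_or_nonempty with rfl | hne
  · exact ⟨(a + b) / 2, (a + b) / 2, by linarith, le_rfl, by linarith, empty_subset _⟩
  · refine ⟨sInf K, sSup K, (hKs (hK.sInf_mem hne)).1, ?_, (hKs (hK.sSup_mem hne)).2, fun x hx =>
      ⟨csInf_le hK.bddBelow hx, le_csSup hK.bddAbove hx⟩⟩
    exact csInf_le_csSup hne hK.bddBelow hK.bddAbove

/-- A test function of zero mean has a test function as its primitive. -/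
theorem IsTestFunction.exists_primitive {a b : ℝ} (hab : a < b) {χ : ℝ → ℝ}
    (hχ : IsTestFunction (Ioo a b) χ) (h0 : ∫ t, χ t = 0) :
    ∃ ζ, IsTestFunction (Ioo a b) ζ ∧ _root_.deriv ζ = χ := by
  obtain ⟨a', b', ha, hle, hb, hK⟩ :=
    exists_Icc_of_isCompact_subset_Ioo hab hχ.hasCompactSupport hχ.tsupport_subset
  have hc := hχ.contDiff.continuous
  have hz : ∀ t, t ∉ Icc a' b' → χ t = 0 := fun t ht =>
    image_eq_zero_of_notMem_tsupport fun h => ht (hK h)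
  have hd : ∀ t, HasDerivAt (fun t => ∫ u in a'..t, χ u) (χ t) t := fun t =>
    intervalIntegral.integral_hasDerivAt_right (hc.intervalIntegrable _ _)
      hc.aestronglyMeasurable.stronglyMeasurableAtFilter hc.continuousAt
  have hderiv : _root_.deriv (fun t => ∫ u in a'..t, χ u) = χ := funext fun t => (hd t).deriv
  have hsupp : Function.support (fun t => ∫ u in a'..t, χ u) ⊆ Icc a' b' := by
    intro t ht
    by_contra hn
    refine ht ?_
    -- To the left of the support the integrand vanishes; to the right the integral is the full
    -- mean, which is zero.
    rcases lt_or_ge t a' with h | h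
    · change ∫ u in a'..t, χ u = 0
      rw [intervalIntegral.integral_symm, neg_eq_zero]
      rw [intervalIntegral.integral_of_le h.le, integral_Ioc_eq_integral_Ioo]
      exact setIntegral_eq_zero_of_forall_eq_zero fun u hu => hz u fun hu' => by
        linarith [hu.2, hu'.1]
    · have h' : b' < t := not_le.1 fun h' => hn ⟨h, h'⟩
      change ∫ u in a'..t, χ u = 0
      rw [intervalIntegral.integral_of_le h, ← integral_Icc_eq_integral_Ioc,
        setIntegral_eq_integral_of_forall_compl_eq_zero, h0]
      exact fun u hu => hz u fun hu' => hu ⟨hu'.1, hu'.2.trans h'.le⟩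
  have hts : tsupport (fun t => ∫ u in a'..t, χ u) ⊆ Icc a' b' :=
    closure_minimal hsupp isClosed_Icc
  refine ⟨_, ⟨?_, ?_, hts.trans fun t ht => ⟨ha.trans_le ht.1, ht.2.trans_lt hb⟩⟩, hderiv⟩
  · exact contDiff_infty_iff_deriv.2 ⟨fun t => (hd t).differentiableAt, hderiv.symm ▸ hχ.contDiff⟩
  · exact isCompact_Icc.of_isClosed_subset (isClosed_tsupport _) hts

/-- Subtracting a multiple of this bump makes the mean of any test function zero, so that the
difference has a primitive among test functions. -/
theorem exists_isTestFunction_integral_eq_one {a b : ℝ} (hab : a < b) :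
    ∃ χ, IsTestFunction (Ioo a b) χ ∧ ∫ t, χ t = 1 := by
  let f : ContDiffBump ((a + b) / 2) := ⟨(b - a) / 8, (b - a) / 4, by linarith, by linarith⟩
  refine ⟨f.normed volume, ⟨f.contDiff_normed, f.hasCompactSupport_normed, ?_⟩, f.integral_normed⟩
  rw [f.tsupport_normed_eq]
  intro t ht
  rw [Metric.mem_closedBall, Real.dist_eq, abs_le] at ht
  change _ ≤ _ ∧ _ ≤ (b - a) / 4 at ht
  have h1 : -((b - a) / 4) ≤ t - (a + b) / 2 := ht.1
  exact ⟨by linarith, by linarith [ht.2]⟩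

/-- Integration by parts against the primitive of an integrable function. -/
theorem integral_deriv_smul_primitive [CompleteSpace F] {a b : ℝ} {ζ : ℝ → ℝ}
    (hζ : IsTestFunction (Ioo a b) ζ) {w : ℝ → F}
    (hw : Integrable w (volume.restrict (Ioo a b))) :
    ∫ s in Ioo a b, deriv ζ s • (∫ t in Ioo a b, (Iio s).indicator w t) =
      - ∫ t in Ioo a b, ζ t • w t := by
  set μ := (volume : Measure ℝ).restrict (Ioo a b)
  have hζ' : Integrable (deriv ζ) μ :=
    (hζ.deriv.contDiff.continuous.integrable_of_hasCompactSupport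
      hζ.deriv.hasCompactSupport).integrableOn
  have hprod : Integrable (fun p : ℝ × ℝ => deriv ζ p.1 • w p.2) (μ.prod μ) :=
    hζ'.smul_prod hw
  have hset : MeasurableSet {p : ℝ × ℝ | p.2 < p.1} := measurableSet_lt measurable_snd measurable_fst
  have hint : Integrable
      (fun p : ℝ × ℝ => deriv ζ p.1 • (Iio p.1).indicator w p.2) (μ.prod μ) := by
    refine (hprod.indicator hset).congr (ae_of_all _ fun p => ?_)
    by_cases h : p.2 < p.1 <;> simp [indicator, h]
  calc ∫ s, deriv ζ s • (∫ t, (Iio s).indicator w t ∂μ) ∂μ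
      = ∫ s, ∫ t, deriv ζ s • (Iio s).indicator w t ∂μ ∂μ := by simp_rw [integral_smul]
    _ = ∫ t, ∫ s, deriv ζ s • (Iio s).indicator w t ∂μ ∂μ := integral_integral_swap hint
    _ = ∫ t, -(ζ t • w t) ∂μ := by
        refine integral_congr_ae ?_
        refine ae_of_all _ fun t => ?_
        have h1 : ∀ s, deriv ζ s • (Iio s).indicator w t
            = ((Ioi t).indicator (deriv ζ) s) • w t := by
          intro s
          by_cases h : t < s <;> simp [indicator, h]
        simp only [h1]
        rw [integral_smul_const]
        -- After the exchange of integrals only ζ' over (t, ∞) is left, which is -ζ(t) by compact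
        -- support.
        have h2 : ∫ s in Ioo a b, (Ioi t).indicator (deriv ζ) s = - ζ t := by
          rw [setIntegral_eq_integral_of_forall_compl_eq_zero, integral_indicator measurableSet_Ioi]
          · exact hζ.hasCompactSupport.integral_Ioi_deriv_eq (hζ.contDiff.of_le (by simp)) t
          · intro s hs
            have : deriv ζ s = 0 := image_eq_zero_of_notMem_tsupport fun h =>
              hs (hζ.deriv.tsupport_subset h)
            by_cases h : t < s <;> simp [indicator, h, this]
        rw [h2, neg_smul]
    _ = _ := integral_neg _

/-- A function with an integrable weak derivative in the first variable is bounded, on almost every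
line, by the integral over that line of its norm and of that of its derivative. -/
theorem exists_enorm_le_lintegral_of_weak_deriv [CompleteSpace F] {a b : ℝ} (hab : a < b)
    {J : Set ℝ} (hJ : IsOpen J) {u v : ℝ × ℝ → F}
    (hu : Integrable u ((volume.restrict (Ioo a b)).prod (volume.restrict J)))
    (hv : Integrable v ((volume.restrict (Ioo a b)).prod (volume.restrict J)))
    (hvm : StronglyMeasurable v)
    (h : ∀ ζ η, IsTestFunction (Ioo a b) ζ → IsTestFunction J η →
      ∫ p, (deriv ζ p.1 * η p.2) • u p ∂((volume.restrict (Ioo a b)).prod (volume.restrict J)) =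
      - ∫ p, (ζ p.1 * η p.2) • v p ∂((volume.restrict (Ioo a b)).prod (volume.restrict J))) :
    ∃ C : ℝ≥0∞, C ≠ ⊤ ∧ ∀ᵐ p ∂((volume.restrict (Ioo a b)).prod (volume.restrict J)),
      ‖u p‖ₑ ≤ C * ∫⁻ t in Ioo a b, (‖u (t, p.2)‖ₑ + ‖v (t, p.2)‖ₑ) := by
  set μ := (volume : Measure ℝ).restrict (Ioo a b)
  set ν := (volume : Measure ℝ).restrict J
  -- The primitive of v in the first variable. It has the same weak derivative as u, so u - U should
  -- depend on the second variable only.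
  set U : ℝ × ℝ → F := fun p => ∫ t, (Iio p.1).indicator (fun t => v (t, p.2)) t ∂μ with hU
  have hUm : StronglyMeasurable U := by
    have hset : MeasurableSet {q : (ℝ × ℝ) × ℝ | q.2 < q.1.1} :=
      measurableSet_lt measurable_snd measurable_fst.fst
    have hm : StronglyMeasurable
        ({q : (ℝ × ℝ) × ℝ | q.2 < q.1.1}.indicator fun q => v (q.2, q.1.2)) :=
      (hvm.comp_measurable (measurable_snd.prodMk measurable_fst.snd)).indicator hset
    exact hm.integral_prod_right' (ν := μ)
  have hUle : ∀ p, ‖U p‖ₑ ≤ ∫⁻ t, ‖v (t, p.2)‖ₑ ∂μ := fun p => by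
    refine (enorm_integral_le_lintegral_enorm _).trans (lintegral_mono fun t => ?_)
    by_cases h : t < p.1 <;> simp [indicator, h]
  have hUint : Integrable U (μ.prod ν) := by
    have hN : Integrable (fun p : ℝ × ℝ => (1 : ℝ) * ∫ t, ‖v (t, p.2)‖ ∂μ) (μ.prod ν) :=
      (integrable_const (1 : ℝ)).mul_prod hv.norm.integral_prod_right
    refine hN.mono' hUm.aestronglyMeasurable ?_
    have : ∀ᵐ p ∂μ.prod ν, Integrable (fun t => v (t, p.2)) μ :=
      Measure.quasiMeasurePreserving_snd.ae hv.prod_left_ae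
    filter_upwards [this] with p hp
    rw [one_mul]
    refine (norm_integral_le_integral_norm _).trans
      (integral_mono_of_nonneg (ae_of_all _ fun _ => norm_nonneg _) hp.norm (ae_of_all _ fun t => ?_))
    by_cases h : t < p.1 <;> simp [indicator, h]
  have hbdd : ∀ χ η, IsTestFunction (Ioo a b) χ → IsTestFunction J η → ∀ f : ℝ × ℝ → F,
      Integrable f (μ.prod ν) → Integrable (fun p => (χ p.1 * η p.2) • f p) (μ.prod ν) := by
    intro χ η hχ hη f hf
    obtain ⟨C, hC⟩ := hχ.exists_bound
    obtain ⟨C', hC'⟩ := hη.exists_bound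
    refine hf.bdd_smul (C * C') ?_ (ae_of_all _ fun p => ?_)
    · exact ((hχ.contDiff.continuous.comp continuous_fst).mul
        (hη.contDiff.continuous.comp continuous_snd)).aestronglyMeasurable
    · rw [norm_mul]
      exact mul_le_mul (hC _) (hC' _) (norm_nonneg _) ((norm_nonneg _).trans (hC p.1))
  have hUtest : ∀ ζ η, IsTestFunction (Ioo a b) ζ → IsTestFunction J η →
      ∫ p, (deriv ζ p.1 * η p.2) • U p ∂μ.prod ν = - ∫ p, (ζ p.1 * η p.2) • v p ∂μ.prod ν := by
    intro ζ η hζ hη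
    rw [integral_prod_symm _ (hbdd _ _ hζ.deriv hη U hUint),
      integral_prod_symm _ (hbdd _ _ hζ hη v hv), ← integral_neg]
    refine integral_congr_ae ?_
    filter_upwards [hv.prod_left_ae] with y hy
    have := integral_deriv_smul_primitive hζ hy
    simp only [mul_comm _ (η y), mul_smul, integral_smul]
    rw [← smul_neg]
    exact congrArg _ this
  have hz : Integrable (fun p => u p - U p) (μ.prod ν) := hu.sub hUint
  have hztest : ∀ ζ η, IsTestFunction (Ioo a b) ζ → IsTestFunction J η →
      ∫ p, (deriv ζ p.1 * η p.2) • (u p - U p) ∂μ.prod ν = 0 := by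
    intro ζ η hζ hη
    simp_rw [smul_sub]
    rw [integral_sub (hbdd _ _ hζ.deriv hη u hu) (hbdd _ _ hζ.deriv hη U hUint), h ζ η hζ hη,
      hUtest ζ η hζ hη, sub_self]
  obtain ⟨χ₀, hχ₀, hχ₀1⟩ := exists_isTestFunction_integral_eq_one hab
  obtain ⟨M, hM⟩ := hχ₀.exists_bound
  -- The candidate for u - U: its mean in the first variable, with weight χ₀.
  set c : ℝ → F := fun y => ∫ t, χ₀ t • (u (t, y) - U (t, y)) ∂μ with hc
  have hχ₀z : Integrable (fun p : ℝ × ℝ => χ₀ p.1 • (u p - U p)) (μ.prod ν) :=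
    hz.bdd_smul M (hχ₀.contDiff.continuous.comp continuous_fst).aestronglyMeasurable
      (ae_of_all _ fun p : ℝ × ℝ => hM p.1)
  have hcint : Integrable c ν := hχ₀z.integral_prod_right
  have hcint' : Integrable (fun p : ℝ × ℝ => c p.2) (μ.prod ν) := by
    simpa using (integrable_const (1 : ℝ)).smul_prod (μ := μ) hcint
  have hae : ∀ᵐ p ∂μ.prod ν, (u p - U p) - c p.2 = 0 := by
    refine ae_eq_zero_of_integral_tensor_eq_zero isOpen_Ioo hJ (hz.sub hcint') ?_
    intro χ η hχ hη
    set m := ∫ t, χ t with hm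
    have hχint : ∫ t, χ t ∂μ = m := setIntegral_eq_integral_of_forall_compl_eq_zero fun t ht =>
      image_eq_zero_of_notMem_tsupport fun h => ht (hχ.tsupport_subset h)
    have hint1 : Integrable χ := hχ.contDiff.continuous.integrable_of_hasCompactSupport
      hχ.hasCompactSupport
    have hint2 : Integrable χ₀ := hχ₀.contDiff.continuous.integrable_of_hasCompactSupport
      hχ₀.hasCompactSupport
    -- Du Bois-Reymond: χ - m χ₀ has zero mean, hence is the derivative of a test function, and u -
    -- U integrates to zero against it.
    have hχ' : IsTestFunction (Ioo a b) (fun t => χ t - m * χ₀ t) := by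
      have hsub : tsupport (fun t => χ t - m * χ₀ t) ⊆ tsupport χ ∪ tsupport χ₀ := by
        refine closure_minimal (fun t ht => ?_) ((isClosed_tsupport _).union (isClosed_tsupport _))
        by_contra hn
        rw [mem_union, not_or] at hn
        refine ht ?_
        simp [image_eq_zero_of_notMem_tsupport hn.1, image_eq_zero_of_notMem_tsupport hn.2]
      refine ⟨hχ.contDiff.sub (contDiff_const.mul hχ₀.contDiff), ?_,
        hsub.trans (union_subset hχ.tsupport_subset hχ₀.tsupport_subset)⟩
      exact (hχ.hasCompactSupport.union hχ₀.hasCompactSupport).of_isClosed_subset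
        (isClosed_tsupport _) hsub
    obtain ⟨ζ, hζ, hζd⟩ := hχ'.exists_primitive hab (by
      rw [integral_sub hint1 (hint2.const_mul m), integral_const_mul, hχ₀1, mul_one, sub_self])
    have h1 := hztest ζ η hζ hη
    rw [hζd] at h1
    have h2 : ∫ p, (χ p.1 * η p.2) • (u p - U p) ∂μ.prod ν
        = m • ∫ p, (χ₀ p.1 * η p.2) • (u p - U p) ∂μ.prod ν := by
      have hi : Integrable (fun p => m • (χ₀ p.1 * η p.2) • (u p - U p)) (μ.prod ν) :=
        (hbdd _ _ hχ₀ hη _ hz).smul m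
      rw [← integral_smul, ← sub_eq_zero, ← integral_sub (hbdd _ _ hχ hη _ hz) hi, ← h1]
      refine integral_congr_ae (ae_of_all _ fun p => ?_)
      simp only [smul_smul, ← sub_smul]
      congr 1
      ring
    have h3 : ∫ p, (χ₀ p.1 * η p.2) • (u p - U p) ∂μ.prod ν = ∫ y, η y • c y ∂ν := by
      rw [integral_prod_symm _ (hbdd _ _ hχ₀ hη _ hz)]
      simp only [mul_comm _ (η _), mul_smul, integral_smul]
      rfl
    have h4 : ∫ p, (χ p.1 * η p.2) • c p.2 ∂μ.prod ν = m • ∫ y, η y • c y ∂ν := by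
      rw [integral_prod_symm _ (hbdd _ _ hχ hη _ hcint')]
      simp only [mul_smul]
      simp_rw [integral_smul_const, hχint, integral_smul]
    simp_rw [smul_sub _ (u _ - U _)]
    rw [integral_sub (hbdd _ _ hχ hη _ hz) (hbdd _ _ hχ hη _ hcint'), h2, h3, h4, sub_self]
  have hfin : μ univ ≠ ⊤ := by simp [μ]
  -- The summand 1 bounds U by N; the rest bounds c, where M is the supremum bound for χ₀ and U ≤ N
  -- is integrated over the interval.
  refine ⟨1 + ENNReal.ofReal M * (1 + μ univ), by finiteness, ?_⟩
  filter_upwards [hae] with p hp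
  set N : ℝ≥0∞ := ∫⁻ t, (‖u (t, p.2)‖ₑ + ‖v (t, p.2)‖ₑ) ∂μ with hN
  have hNu : ∫⁻ t, ‖u (t, p.2)‖ₑ ∂μ ≤ N := lintegral_mono fun t => le_self_add
  have hNv : ∫⁻ t, ‖v (t, p.2)‖ₑ ∂μ ≤ N := lintegral_mono fun t => le_add_self
  have hcle : ‖c p.2‖ₑ ≤ ENNReal.ofReal M * (1 + μ univ) * N := by
    calc ‖c p.2‖ₑ ≤ ∫⁻ t, ‖χ₀ t • (u (t, p.2) - U (t, p.2))‖ₑ ∂μ :=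
          enorm_integral_le_lintegral_enorm _
      _ ≤ ∫⁻ t, ENNReal.ofReal M * (‖u (t, p.2)‖ₑ + N) ∂μ := by
          refine lintegral_mono fun t => ?_
          rw [enorm_smul]
          refine mul_le_mul' ?_ ((enorm_sub_le).trans (add_le_add le_rfl ((hUle _).trans hNv)))
          rw [← ofReal_norm]
          exact ENNReal.ofReal_le_ofReal (hM t)
      _ = ENNReal.ofReal M * (∫⁻ t, ‖u (t, p.2)‖ₑ ∂μ + N * μ univ) := by
          rw [lintegral_const_mul' _ _ ENNReal.ofReal_ne_top,
            lintegral_add_right _ measurable_const, lintegral_const]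
      _ ≤ ENNReal.ofReal M * (N + N * μ univ) := by gcongr
      _ = ENNReal.ofReal M * (1 + μ univ) * N := by ring
  have hup : u p = U p + c p.2 := by
    rw [sub_sub, sub_eq_zero] at hp; exact hp
  rw [hup, add_mul, one_mul]
  exact (enorm_add_le _ _).trans (add_le_add ((hUle p).trans hNv) hcle)

/-! ### The L⁴ embedding on a rectangle. -/

/-- Cauchy–Schwarz against the constant 1 on each line, then Tonelli. It makes the line bounds for u
square integrable in the remaining variable. -/
theorem lintegral_sq_lintegral_lt_top {α β : Type*} [MeasurableSpace α] [MeasurableSpace β]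
    {μ : Measure α} [IsFiniteMeasure μ] {ν : Measure β} [SFinite ν] {H : α × β → ℝ≥0∞}
    (hH : AEMeasurable H (μ.prod ν)) (hfin : ∫⁻ p, H p ^ 2 ∂μ.prod ν < ⊤) :
    ∫⁻ y, (∫⁻ x, H (x, y) ∂μ) ^ 2 ∂ν < ⊤ := by
  have hsq : ∀ᵐ y ∂ν, (∫⁻ x, H (x, y) ∂μ) ^ 2 ≤ μ univ * ∫⁻ x, H (x, y) ^ 2 ∂μ := by
    filter_upwards [hH.aestronglyMeasurable.prodMk_right] with y hy
    have hy' : AEMeasurable (fun x => H (x, y)) μ := hy.aemeasurable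
    have h := ENNReal.lintegral_mul_le_Lp_mul_Lq μ Real.HolderConjugate.two_two hy'
      (aemeasurable_const (b := (1 : ℝ≥0∞)))
    simp only [Pi.mul_apply, mul_one, ENNReal.one_rpow, lintegral_const, one_mul] at h
    calc (∫⁻ x, H (x, y) ∂μ) ^ 2
        ≤ ((∫⁻ x, H (x, y) ^ (2 : ℝ) ∂μ) ^ (1 / 2 : ℝ) * μ univ ^ (1 / 2 : ℝ)) ^ 2 := by gcongr
      _ = μ univ * ∫⁻ x, H (x, y) ^ 2 ∂μ := by
          rw [mul_pow, ← ENNReal.rpow_natCast, ← ENNReal.rpow_natCast, ← ENNReal.rpow_mul,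
            ← ENNReal.rpow_mul]
          norm_num
          rw [mul_comm]
  calc ∫⁻ y, (∫⁻ x, H (x, y) ∂μ) ^ 2 ∂ν ≤ ∫⁻ y, μ univ * ∫⁻ x, H (x, y) ^ 2 ∂μ ∂ν :=
        lintegral_mono_ae hsq
    _ = μ univ * ∫⁻ p, H p ^ 2 ∂μ.prod ν := by
        rw [lintegral_const_mul' _ _ (measure_ne_top μ _), lintegral_prod_symm _ (hH.pow_const 2)]
    _ < ⊤ := ENNReal.mul_lt_top (measure_lt_top μ _) hfin

theorem lintegral_sq_enorm_add_lt_top {α E : Type*} [NormedAddCommGroup E] [MeasurableSpace α]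
    {μ : Measure α} {u v : α → E} (hu : MemLp u 2 μ) (hv : MemLp v 2 μ) :
    ∫⁻ x, (‖u x‖ₑ + ‖v x‖ₑ) ^ 2 ∂μ < ⊤ := by
  have h := (hu.norm.add hv.norm).2
  rw [eLpNorm_lt_top_iff_lintegral_rpow_enorm_lt_top (by norm_num) (by norm_num)] at h
  refine lt_of_eq_of_lt (lintegral_congr fun x => ?_) h
  rw [Pi.add_apply, Real.enorm_of_nonneg (by positivity), ENNReal.ofReal_add (by positivity)
    (by positivity), ofReal_norm, ofReal_norm]
  norm_num

/-- On a rectangle, a square integrable function with square integrable weak derivatives is in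
`L⁴`. -/
theorem memLp_four_of_weak_derivs [CompleteSpace F] {a b c d : ℝ} (hab : a < b) (hcd : c < d)
    {u v w : ℝ × ℝ → F}
    (hu : MemLp u 2 ((volume.restrict (Ioo a b)).prod (volume.restrict (Ioo c d))))
    (hv : MemLp v 2 ((volume.restrict (Ioo a b)).prod (volume.restrict (Ioo c d))))
    (hw : MemLp w 2 ((volume.restrict (Ioo a b)).prod (volume.restrict (Ioo c d))))
    (h1 : ∀ ζ η, IsTestFunction (Ioo a b) ζ → IsTestFunction (Ioo c d) η →
      ∫ p, (deriv ζ p.1 * η p.2) • u p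
        ∂((volume.restrict (Ioo a b)).prod (volume.restrict (Ioo c d))) =
      - ∫ p, (ζ p.1 * η p.2) • v p
        ∂((volume.restrict (Ioo a b)).prod (volume.restrict (Ioo c d))))
    (h2 : ∀ ζ η, IsTestFunction (Ioo a b) ζ → IsTestFunction (Ioo c d) η →
      ∫ p, (ζ p.1 * deriv η p.2) • u p
        ∂((volume.restrict (Ioo a b)).prod (volume.restrict (Ioo c d))) =
      - ∫ p, (ζ p.1 * η p.2) • w p
        ∂((volume.restrict (Ioo a b)).prod (volume.restrict (Ioo c d)))) :
    MemLp u 4 ((volume.restrict (Ioo a b)).prod (volume.restrict (Ioo c d))) := by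
  set μ := (volume : Measure ℝ).restrict (Ioo a b)
  set ν := (volume : Measure ℝ).restrict (Ioo c d)
  -- The bound along lines asks for a strongly measurable derivative; the weak identities do not see
  -- the change of representative.
  wlog hvm : StronglyMeasurable v generalizing v
  · refine this (hv.ae_eq hv.1.ae_eq_mk) ?_ hv.1.stronglyMeasurable_mk
    intro ζ η hζ hη
    rw [h1 ζ η hζ hη]
    congr 1
    refine integral_congr_ae ?_
    filter_upwards [hv.1.ae_eq_mk] with p hp
    rw [← hp]
  wlog hwm : StronglyMeasurable w generalizing w
  · refine this (hw.ae_eq hw.1.ae_eq_mk) ?_ hw.1.stronglyMeasurable_mk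
    intro ζ η hζ hη
    rw [h2 ζ η hζ hη]
    congr 1
    refine integral_congr_ae ?_
    filter_upwards [hw.1.ae_eq_mk] with p hp
    rw [← hp]
  have hint : ∀ {f : ℝ × ℝ → F}, MemLp f 2 (μ.prod ν) → Integrable f (μ.prod ν) := fun hf =>
    hf.integrable one_le_two
  obtain ⟨C, hC, hle⟩ := exists_enorm_le_lintegral_of_weak_deriv hab isOpen_Ioo (hint hu) (hint hv)
    hvm h1
  -- The bound on the lines of the other direction comes from exchanging the two variables.
  obtain ⟨C', hC', hle'⟩ := exists_enorm_le_lintegral_of_weak_deriv (u := fun p => u p.swap)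
    (v := fun p => w p.swap) hcd isOpen_Ioo (hint hu).swap (hint hw).swap
    (hwm.comp_measurable measurable_swap) (by
      intro ζ η hζ hη
      have := h2 η ζ hη hζ
      rw [← integral_prod_swap, ← integral_prod_swap (fun p => (η p.1 * ζ p.2) • w p)] at this
      simpa only [Prod.fst_swap, Prod.snd_swap, mul_comm] using this)
  have hle'' : ∀ᵐ p ∂μ.prod ν, ‖u p‖ₑ ≤
      C' * ∫⁻ t, (‖u (p.1, t)‖ₑ + ‖w (p.1, t)‖ₑ) ∂ν :=
    (Measure.measurePreserving_swap (μ := μ) (ν := ν)).quasiMeasurePreserving.ae hle'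
  have hmv : AEMeasurable (fun p => ‖u p‖ₑ + ‖v p‖ₑ) (μ.prod ν) := hu.1.enorm.add hv.1.enorm
  have hmw : AEMeasurable (fun p => ‖u p‖ₑ + ‖w p‖ₑ) (μ.prod ν) := hu.1.enorm.add hw.1.enorm
  have hα := lintegral_sq_lintegral_lt_top hmv (lintegral_sq_enorm_add_lt_top hu hv)
  have hβ := lintegral_sq_lintegral_lt_top (μ := ν) (ν := μ) hmw.prod_swap (by
    rw [lintegral_prod_swap (fun p => (‖u p‖ₑ + ‖w p‖ₑ) ^ 2)]
    exact lintegral_sq_enorm_add_lt_top hu hw)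
  refine ⟨hu.1, ?_⟩
  rw [eLpNorm_lt_top_iff_lintegral_rpow_enorm_lt_top (by norm_num) (by norm_num)]
  -- One factor |u|² is bounded by a function of the second variable, the other by a function of the
  -- first, so the double integral splits into a product.
  calc ∫⁻ p, ‖u p‖ₑ ^ (4 : ℝ≥0∞).toReal ∂μ.prod ν
      ≤ ∫⁻ p, (C * C') ^ 2 * ((∫⁻ t, (‖u (p.1, t)‖ₑ + ‖w (p.1, t)‖ₑ) ∂ν) ^ 2 *
          (∫⁻ t, (‖u (t, p.2)‖ₑ + ‖v (t, p.2)‖ₑ) ∂μ) ^ 2) ∂μ.prod ν := by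
        refine lintegral_mono_ae ?_
        filter_upwards [hle, hle''] with p hp hp'
        calc ‖u p‖ₑ ^ (4 : ℝ≥0∞).toReal = ‖u p‖ₑ ^ 2 * ‖u p‖ₑ ^ 2 := by
              rw [← pow_add, ← ENNReal.rpow_natCast]; norm_num
          _ ≤ (C * ∫⁻ t, (‖u (t, p.2)‖ₑ + ‖v (t, p.2)‖ₑ) ∂μ) ^ 2 *
              (C' * ∫⁻ t, (‖u (p.1, t)‖ₑ + ‖w (p.1, t)‖ₑ) ∂ν) ^ 2 := by gcongr
          _ = _ := by ring
    _ = (C * C') ^ 2 * ((∫⁻ x, (∫⁻ t, (‖u (x, t)‖ₑ + ‖w (x, t)‖ₑ) ∂ν) ^ 2 ∂μ) *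
          ∫⁻ y, (∫⁻ t, (‖u (t, y)‖ₑ + ‖v (t, y)‖ₑ) ∂μ) ^ 2 ∂ν) := by
        rw [lintegral_const_mul' _ _ (by finiteness), lintegral_prod_mul
            (f := fun x => (∫⁻ t, (‖u (x, t)‖ₑ + ‖w (x, t)‖ₑ) ∂ν) ^ 2)
            (g := fun y => (∫⁻ t, (‖u (t, y)‖ₑ + ‖v (t, y)‖ₑ) ∂μ) ^ 2)]
        · exact hmw.lintegral_prod_right'.pow_const 2
        · exact hmv.lintegral_prod_left'.pow_const 2
    _ < ⊤ := ENNReal.mul_lt_top (by finiteness) (ENNReal.mul_lt_top hβ hα)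

end Rectangle

/-! ### The standard parametrization of a surface of revolution -/

/-- The radial unit vector. -/
def er (θ : ℝ) : E3 := !₂[Real.cos θ, Real.sin θ, 0]

/-- The angular unit vector. -/
def eth (θ : ℝ) : E3 := !₂[-Real.sin θ, Real.cos θ, 0]

/-- The axial unit vector. -/
def ez : E3 := !₂[0, 0, 1]

theorem hasDerivAt_vec {f : ℝ → E3} {f' : E3} {t : ℝ}
    (h : ∀ i, HasDerivAt (fun t => f t i) (f' i) t) : HasDerivAt f f' t := by
  have h' : HasDerivAt (fun t i => f t i) (fun i => f' i) t := hasDerivAt_pi.2 h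
  exact (PiLp.continuousLinearEquiv 2 ℝ (fun _ : Fin 3 => ℝ)).symm.hasFDerivAt.comp_hasDerivAt t h'

theorem hasDerivAt_er (θ : ℝ) : HasDerivAt er (eth θ) θ := by
  refine hasDerivAt_vec fun i => ?_
  fin_cases i
  · simpa [er, eth] using Real.hasDerivAt_cos θ
  · simpa [er, eth] using Real.hasDerivAt_sin θ
  · simpa [er, eth] using hasDerivAt_const θ (0 : ℝ)

theorem hasDerivAt_eth (θ : ℝ) : HasDerivAt eth (-er θ) θ := by
  refine hasDerivAt_vec fun i => ?_
  fin_cases i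
  · simpa [er, eth] using (Real.hasDerivAt_sin θ).fun_neg
  · simpa [er, eth] using Real.hasDerivAt_cos θ
  · simpa [er, eth] using hasDerivAt_const θ (0 : ℝ)

theorem contDiff_er {n : WithTop ℕ∞} : ContDiff ℝ n er := by
  rw [contDiff_euclidean]
  intro i
  fin_cases i
  · simpa [er] using Real.contDiff_cos
  · simpa [er] using Real.contDiff_sin
  · simpa [er] using contDiff_const

theorem contDiff_eth {n : WithTop ℕ∞} : ContDiff ℝ n eth := by
  rw [contDiff_euclidean]
  intro i
  fin_cases i
  · simpa [eth] using Real.contDiff_sin.neg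
  · simpa [eth] using Real.contDiff_cos
  · simpa [eth] using contDiff_const

theorem inner_er_er (θ : ℝ) : ⟪er θ, er θ⟫_ℝ = 1 := by
  rw [PiLp.inner_apply, Fin.sum_univ_three]
  simp [er]

theorem inner_eth_eth (θ : ℝ) : ⟪eth θ, eth θ⟫_ℝ = 1 := by
  rw [PiLp.inner_apply, Fin.sum_univ_three]
  simp [eth]

theorem inner_ez_ez : ⟪ez, ez⟫_ℝ = 1 := by
  rw [PiLp.inner_apply, Fin.sum_univ_three]
  simp [ez]

theorem inner_er_eth (θ : ℝ) : ⟪er θ, eth θ⟫_ℝ = 0 := by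
  simp [er, eth, PiLp.inner_apply, Fin.sum_univ_three]; ring

theorem inner_eth_er (θ : ℝ) : ⟪eth θ, er θ⟫_ℝ = 0 := by
  rw [real_inner_comm, inner_er_eth]

theorem inner_er_ez (θ : ℝ) : ⟪er θ, ez⟫_ℝ = 0 := by
  simp [er, ez, PiLp.inner_apply, Fin.sum_univ_three]

theorem inner_ez_er (θ : ℝ) : ⟪ez, er θ⟫_ℝ = 0 := by
  rw [real_inner_comm, inner_er_ez]

theorem inner_eth_ez (θ : ℝ) : ⟪eth θ, ez⟫_ℝ = 0 := by
  simp [eth, ez, PiLp.inner_apply, Fin.sum_univ_three]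

theorem inner_ez_eth (θ : ℝ) : ⟪ez, eth θ⟫_ℝ = 0 := by
  rw [real_inner_comm, inner_eth_ez]

/-- A positive profile, of class `C²` inside the interval and `C¹` on the line. -/
structure IsProfile (s₀ s₁ : ℝ) (g : ℝ → ℝ) : Prop where
  lt : s₀ < s₁
  contDiff : ContDiff ℝ 1 g
  contDiffOn : ContDiffOn ℝ 2 g (Ioo s₀ s₁)
  pos : ∀ s ∈ Icc s₀ s₁, 0 < g s

/-- The standard parametrization of the surface of revolution. -/
def param (Φ : E3 ≃ᵃⁱ[ℝ] E3) (g : ℝ → ℝ) (p : ℝ × ℝ) : E3 := Φ (g p.1 • er p.2 + p.1 • ez)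

/-- The tangent vector of the meridians. -/
def tauS (Φ : E3 ≃ᵃⁱ[ℝ] E3) (g : ℝ → ℝ) (p : ℝ × ℝ) : E3 :=
  Φ.linearIsometryEquiv (deriv g p.1 • er p.2 + ez)

/-- The tangent vector of the parallels. -/
def tauT (Φ : E3 ≃ᵃⁱ[ℝ] E3) (g : ℝ → ℝ) (p : ℝ × ℝ) : E3 :=
  Φ.linearIsometryEquiv (g p.1 • eth p.2)

/-- The axial coordinate and the angle of a point. -/
def coords (Φ : E3 ≃ᵃⁱ[ℝ] E3) (x : E3) : ℝ × ℝ :=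
  (Φ.symm x 2, Complex.arg ⟨Φ.symm x 0, Φ.symm x 1⟩)

variable {Φ : E3 ≃ᵃⁱ[ℝ] E3} {s₀ s₁ : ℝ} {g : ℝ → ℝ}

/-! ### Coordinates off the axis and functions periodic in the angle. -/

theorem vec_eq (s θ : ℝ) :
    (!₂[g s * Real.cos θ, g s * Real.sin θ, s] : E3) = g s • er θ + s • ez := by
  ext i; fin_cases i <;> simp [er, ez]

theorem isometryEquiv_apply (Φ : E3 ≃ᵃⁱ[ℝ] E3) (v : E3) : Φ v = Φ.linearIsometryEquiv v + Φ 0 := by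
  simpa using Φ.map_vadd 0 v

theorem hasFDerivAt_isometryEquiv (Φ : E3 ≃ᵃⁱ[ℝ] E3) (v : E3) :
    HasFDerivAt Φ (Φ.linearIsometryEquiv.toContinuousLinearEquiv : E3 →L[ℝ] E3) v := by
  have h : (Φ : E3 → E3) = fun v => Φ.linearIsometryEquiv v + Φ 0 :=
    funext (isometryEquiv_apply Φ)
  rw [h]
  exact (Φ.linearIsometryEquiv.toContinuousLinearEquiv : E3 →L[ℝ] E3).hasFDerivAt.add_const _

theorem contDiff_isometryEquiv (Φ : E3 ≃ᵃⁱ[ℝ] E3) {n : WithTop ℕ∞} : ContDiff ℝ n Φ := by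
  have h : (Φ : E3 → E3) = fun v => Φ.linearIsometryEquiv v + Φ 0 :=
    funext (isometryEquiv_apply Φ)
  rw [h]
  exact Φ.linearIsometryEquiv.contDiff.add contDiff_const

theorem surfaceOfRevolution_eq_image :
    surfaceOfRevolution Φ s₀ s₁ g = param Φ g '' (Icc s₀ s₁ ×ˢ univ) := by
  ext x
  constructor
  · rintro ⟨s, hs, θ, rfl⟩
    exact ⟨(s, θ), ⟨hs, mem_univ _⟩, by rw [vec_eq]; rfl⟩
  · rintro ⟨⟨s, θ⟩, ⟨hs, -⟩, rfl⟩
    exact ⟨s, hs, θ, by rw [vec_eq]; rfl⟩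

/-- The strip (-π, π] is the range of the principal argument, so `coords` is an exact inverse there.
-/
theorem coords_param {p : ℝ × ℝ} (hp : 0 < g p.1) (hθ : p.2 ∈ Ioc (-Real.pi) Real.pi) :
    coords Φ (param Φ g p) = p := by
  have h : (⟨g p.1 * Real.cos p.2, g p.1 * Real.sin p.2⟩ : ℂ)
      = (g p.1 : ℂ) * (Complex.cos p.2 + Complex.sin p.2 * Complex.I) := by
    apply Complex.ext <;> simp [Complex.cos_ofReal_re, Complex.sin_ofReal_re]
  refine Prod.ext ?_ ?_
  · simp [coords, param, er, ez]
  · have := Complex.arg_mul_cos_add_sin_mul_I hp hθ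
    rw [← h] at this
    simpa [coords, param, er, ez] using this

theorem param_add_int_mul (s θ : ℝ) (n : ℤ) :
    param Φ g (s, θ + n * (2 * Real.pi)) = param Φ g (s, θ) := by
  simp [param, er, Real.cos_add_int_mul_two_pi, Real.sin_add_int_mul_two_pi]

theorem exists_add_int_mul_mem_Ioc (θ : ℝ) :
    ∃ n : ℤ, θ + n * (2 * Real.pi) ∈ Ioc (-Real.pi) Real.pi := by
  obtain ⟨n, hn, -⟩ := existsUnique_add_zsmul_mem_Ioc Real.two_pi_pos θ (-Real.pi)
  refine ⟨n, ?_⟩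
  have : -Real.pi + 2 * Real.pi = Real.pi := by ring
  rw [this] at hn
  simpa using hn

theorem surfaceOfRevolution_eq_image_Ioc :
    surfaceOfRevolution Φ s₀ s₁ g = param Φ g '' (Icc s₀ s₁ ×ˢ Ioc (-Real.pi) Real.pi) := by
  rw [surfaceOfRevolution_eq_image]
  refine Subset.antisymm ?_ (image_mono (prod_mono_right (subset_univ _)))
  rintro _ ⟨⟨s, θ⟩, ⟨hs, -⟩, rfl⟩
  obtain ⟨n, hn⟩ := exists_add_int_mul_mem_Ioc θ
  exact ⟨(s, θ + n * (2 * Real.pi)), ⟨hs, hn⟩, param_add_int_mul s θ n⟩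

/-- A function of `(s, θ)` that is `2π`-periodic in `θ`. -/
def AnglePeriodic {F : Type*} (f : ℝ × ℝ → F) : Prop :=
  ∀ s θ, f (s, θ + 2 * Real.pi) = f (s, θ)

theorem AnglePeriodic.add_int_mul {F : Type*} {f : ℝ × ℝ → F} (hf : AnglePeriodic f) (s θ : ℝ)
    (n : ℤ) : f (s, θ + n * (2 * Real.pi)) = f (s, θ) := by
  have : Function.Periodic (fun θ => f (s, θ)) (2 * Real.pi) := hf s
  exact this.int_mul n θ

/-- Passing through the surface changes the angle by a multiple of 2π only, which a periodic
function does not see. -/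
theorem AnglePeriodic.comp_coords_param {F : Type*} {f : ℝ × ℝ → F} (hf : AnglePeriodic f)
    {p : ℝ × ℝ} (hp : 0 < g p.1) : f (coords Φ (param Φ g p)) = f p := by
  obtain ⟨n, hn⟩ := exists_add_int_mul_mem_Ioc p.2
  have h1 : param Φ g p = param Φ g (p.1, p.2 + n * (2 * Real.pi)) :=
    (param_add_int_mul p.1 p.2 n).symm
  rw [h1, coords_param (p := (p.1, p.2 + n * (2 * Real.pi))) hp hn]
  exact hf.add_int_mul p.1 p.2 n

theorem measurable_coords : Measurable (coords Φ) := by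
  have h : Continuous fun x : E3 => Φ.symm x := Φ.symm.continuous
  have hi : ∀ i : Fin 3, Continuous fun x : E3 => Φ.symm x i := fun i =>
    (EuclideanSpace.proj (𝕜 := ℝ) i).continuous.comp h
  refine (hi 2).measurable.prodMk (Complex.measurable_arg.comp ?_)
  have : (fun x : E3 => (⟨Φ.symm x 0, Φ.symm x 1⟩ : ℂ)) =
      fun x => ((Φ.symm x 0 : ℝ) : ℂ) + ((Φ.symm x 1 : ℝ) : ℂ) * Complex.I := by
    ext x; apply Complex.ext <;> simp
  rw [this]
  exact ((Complex.continuous_ofReal.comp (hi 0)).add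
    ((Complex.continuous_ofReal.comp (hi 1)).mul continuous_const)).measurable

/-- Periodic `C¹` functions of `(s, θ)` are `C¹` functions of the point, off the axis. -/
theorem AnglePeriodic.contDiffAt_comp_coords {F : Type*} [NormedAddCommGroup F] [NormedSpace ℝ F]
    {n : WithTop ℕ∞} {f : ℝ × ℝ → F} (hf : AnglePeriodic f) (hfd : ContDiff ℝ n f) {x : E3}
    (hx : (⟨Φ.symm x 0, Φ.symm x 1⟩ : ℂ) ≠ 0) :
    ContDiffAt ℝ n (fun x => f (coords Φ x)) x := by
  have hi : ∀ i : Fin 3, ContDiff ℝ n fun x : E3 => Φ.symm x i := fun i =>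
    (EuclideanSpace.proj (𝕜 := ℝ) i).contDiff.comp (contDiff_isometryEquiv Φ.symm)
  have hc : ContDiff ℝ n fun x : E3 => (⟨Φ.symm x 0, Φ.symm x 1⟩ : ℂ) := by
    have : (fun x : E3 => (⟨Φ.symm x 0, Φ.symm x 1⟩ : ℂ)) =
        fun x => Complex.equivRealProdCLM.symm (Φ.symm x 0, Φ.symm x 1) := by
      ext x; apply Complex.ext <;> simp
    rw [this]
    exact Complex.equivRealProdCLM.symm.contDiff.comp ((hi 0).prodMk (hi 1))
  have harg : ∀ z : ℂ, z ∈ Complex.slitPlane → ContDiffAt ℝ n Complex.arg z := by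
    intro z hz
    have h1 : ContDiffAt ℝ n Complex.log z := (Complex.contDiffAt_log hz).restrict_scalars ℝ
    have h2 : Complex.arg = fun z => Complex.imCLM (Complex.log z) := by
      ext z; simp [Complex.log_im]
    rw [h2]
    exact Complex.imCLM.contDiff.contDiffAt.comp z h1
  by_cases hslit : (⟨Φ.symm x 0, Φ.symm x 1⟩ : ℂ) ∈ Complex.slitPlane
  · refine hfd.contDiffAt.comp x ((hi 2).contDiffAt.prodMk ?_)
    exact (harg _ hslit).comp x hc.contDiffAt
  -- On the branch cut, use arg(-z) + π instead: it is smooth there and differs from arg z by a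
  -- multiple of 2π, which f ignores.
  · have hneg : -(⟨Φ.symm x 0, Φ.symm x 1⟩ : ℂ) ∈ Complex.slitPlane := by
      rw [Complex.mem_slitPlane_iff] at hslit ⊢
      push Not at hslit
      simp only [Complex.neg_re, Complex.neg_im] at hslit ⊢
      left
      rcases hslit.1.lt_or_eq with h | h
      · simpa using h
      · exact absurd (Complex.ext h hslit.2) hx
    have hloc : ContDiffAt ℝ n (fun x : E3 => f (Φ.symm x 2,
        Complex.arg (-(⟨Φ.symm x 0, Φ.symm x 1⟩ : ℂ)) + Real.pi)) x := by
      refine hfd.contDiffAt.comp x ((hi 2).contDiffAt.prodMk (ContDiffAt.add ?_ contDiffAt_const))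
      exact (harg _ hneg).comp x hc.neg.contDiffAt
    refine hloc.congr_of_eventuallyEq ?_
    have hne : ∀ᶠ y : E3 in 𝓝 x, (⟨Φ.symm y 0, Φ.symm y 1⟩ : ℂ) ≠ 0 :=
      hc.continuous.continuousAt.eventually_ne hx
    filter_upwards [hne] with y hy
    have hang : ((Complex.arg (-(⟨Φ.symm y 0, Φ.symm y 1⟩ : ℂ)) + Real.pi : ℝ) : Real.Angle)
        = (Complex.arg (⟨Φ.symm y 0, Φ.symm y 1⟩ : ℂ) : Real.Angle) := by
      rw [Real.Angle.coe_add, Complex.arg_neg_coe_angle hy, add_assoc, Real.Angle.coe_pi_add_coe_pi,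
        add_zero]
    obtain ⟨k, hk⟩ := Real.Angle.angle_eq_iff_two_pi_dvd_sub.1 hang
    have hk' : Complex.arg (-(⟨Φ.symm y 0, Φ.symm y 1⟩ : ℂ)) + Real.pi
        = Complex.arg (⟨Φ.symm y 0, Φ.symm y 1⟩ : ℂ) + k * (2 * Real.pi) := by linarith
    rw [hk', hf.add_int_mul]
    rfl

/-! ### The differential of the parametrization and the tangent space. -/

theorem continuous_er : Continuous er := (contDiff_er (n := 0)).continuous

theorem continuous_eth : Continuous eth := (contDiff_eth (n := 0)).continuous

theorem IsProfile.continuous_deriv (hg : IsProfile s₀ s₁ g) : Continuous (deriv g) :=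
  hg.contDiff.continuous_deriv le_rfl

theorem IsProfile.continuous_tauS (hg : IsProfile s₀ s₁ g) : Continuous (tauS Φ g) := by
  refine Φ.linearIsometryEquiv.continuous.comp (Continuous.add ?_ continuous_const)
  exact (hg.continuous_deriv.comp continuous_fst).smul (continuous_er.comp continuous_snd)

theorem IsProfile.continuous_tauT (hg : IsProfile s₀ s₁ g) : Continuous (tauT Φ g) :=
  Φ.linearIsometryEquiv.continuous.comp
    ((hg.contDiff.continuous.comp continuous_fst).smul (continuous_eth.comp continuous_snd))

theorem IsProfile.contDiff_param (hg : IsProfile s₀ s₁ g) : ContDiff ℝ 1 (param Φ g) :=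
  (contDiff_isometryEquiv Φ).comp (((hg.contDiff.comp contDiff_fst).smul
    (contDiff_er.comp contDiff_snd)).add (contDiff_fst.smul contDiff_const))

/-- The differential of the standard parametrization. -/
def paramDeriv (Φ : E3 ≃ᵃⁱ[ℝ] E3) (g : ℝ → ℝ) (p : ℝ × ℝ) : ℝ × ℝ →L[ℝ] E3 :=
  (ContinuousLinearMap.fst ℝ ℝ ℝ).smulRight (tauS Φ g p) +
    (ContinuousLinearMap.snd ℝ ℝ ℝ).smulRight (tauT Φ g p)

@[simp]
theorem paramDeriv_apply (p v : ℝ × ℝ) :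
    paramDeriv Φ g p v = v.1 • tauS Φ g p + v.2 • tauT Φ g p := rfl

theorem IsProfile.hasFDerivAt_param (hg : IsProfile s₀ s₁ g) (p : ℝ × ℝ) :
    HasFDerivAt (param Φ g) (paramDeriv Φ g p) p := by
  have h1 : HasFDerivAt (fun p : ℝ × ℝ => g p.1)
      ((ContinuousLinearMap.fst ℝ ℝ ℝ).smulRight (deriv g p.1)) p := by
    have := ((hg.contDiff.differentiable one_ne_zero p.1).hasDerivAt).hasFDerivAt.comp p
      (hasFDerivAt_fst (𝕜 := ℝ) (p := p))
    refine this.congr_fderiv ?_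
    ext <;> simp
  have h2 : HasFDerivAt (fun p : ℝ × ℝ => er p.2)
      ((ContinuousLinearMap.snd ℝ ℝ ℝ).smulRight (eth p.2)) p := by
    have := (hasDerivAt_er p.2).hasFDerivAt.comp p (hasFDerivAt_snd (𝕜 := ℝ) (p := p))
    refine this.congr_fderiv ?_
    ext <;> simp
  have h3 : HasFDerivAt (fun p : ℝ × ℝ => p.1 • ez)
      ((ContinuousLinearMap.fst ℝ ℝ ℝ).smulRight ez) p :=
    ((ContinuousLinearMap.fst ℝ ℝ ℝ).smulRight ez).hasFDerivAt
  refine ((hasFDerivAt_isometryEquiv Φ _).comp p ((h1.smul h2).add h3)).congr_fderiv ?_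
  refine ContinuousLinearMap.ext fun v => ?_
  simp only [paramDeriv_apply, tauS, tauT, ← map_smul, ← map_add]
  simp
  module

theorem inner_tauS_tauT (p : ℝ × ℝ) : ⟪tauS Φ g p, tauT Φ g p⟫_ℝ = 0 := by
  rw [tauS, tauT, LinearIsometryEquiv.inner_map_map]
  simp [inner_add_left, inner_smul_left, inner_smul_right, inner_er_eth, inner_ez_eth]

theorem inner_tauS_tauS (p : ℝ × ℝ) :
    ⟪tauS Φ g p, tauS Φ g p⟫_ℝ = deriv g p.1 ^ 2 + 1 := by
  rw [tauS, LinearIsometryEquiv.inner_map_map]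
  simp only [inner_add_left, inner_add_right, inner_smul_left, inner_smul_right, inner_er_er,
    inner_er_ez, inner_ez_er, inner_ez_ez]
  simp; ring

theorem inner_tauT_tauT (p : ℝ × ℝ) : ⟪tauT Φ g p, tauT Φ g p⟫_ℝ = g p.1 ^ 2 := by
  rw [tauT, LinearIsometryEquiv.inner_map_map]
  simp only [inner_smul_left, inner_smul_right, inner_eth_eth]
  simp; ring

/-- The tangent space is spanned by the two coordinate directions, also at boundary points. -/
theorem IsProfile.tangentSpaceAt_param (hg : IsProfile s₀ s₁ g) {p : ℝ × ℝ}
    (hp : p.1 ∈ Icc s₀ s₁) :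
    tangentSpaceAt (surfaceOfRevolution Φ s₀ s₁ g) (param Φ g p) =
      Submodule.span ℝ {tauS Φ g p, tauT Φ g p} := by
  refine le_antisymm (Submodule.span_le.2 fun v hv => ?_) ?_
  · set L := Φ.linearIsometryEquiv
    have hpos := hg.pos _ hp
    -- the defining function
    let f : E3 → ℝ := fun x => (Φ.symm x 0) ^ 2 + (Φ.symm x 1) ^ 2 - g (Φ.symm x 2) ^ 2
    have hi : ∀ (i : Fin 3) (x : E3), HasFDerivAt (fun x : E3 => Φ.symm x i)
        ((EuclideanSpace.proj i : E3 →L[ℝ] ℝ) ∘L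
          (Φ.symm.linearIsometryEquiv.toContinuousLinearEquiv : E3 →L[ℝ] E3)) x := fun i x =>
      (EuclideanSpace.proj i : E3 →L[ℝ] ℝ).hasFDerivAt.comp x (hasFDerivAt_isometryEquiv Φ.symm x)
    have hgd : HasDerivAt g (deriv g p.1) (Φ.symm (param Φ g p) 2) := by
      have : Φ.symm (param Φ g p) 2 = p.1 := by simp [param, er, ez]
      rw [this]
      exact (hg.contDiff.differentiable one_ne_zero p.1).hasDerivAt
    have hfd := (((hi 0 (param Φ g p)).pow 2).add ((hi 1 (param Φ g p)).pow 2)).sub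
      ((HasDerivAt.comp_hasFDerivAt (f := fun x : E3 => Φ.symm x 2) (param Φ g p) hgd
        (hi 2 (param Φ g p))).pow 2)
    -- f vanishes on S, so 0 is a derivative of f within S; vectors of the tangent cone therefore
    -- lie in the kernel of the true derivative.
    have hz : HasFDerivWithinAt f (0 : E3 →L[ℝ] ℝ) (surfaceOfRevolution Φ s₀ s₁ g)
        (param Φ g p) := by
      have hf0 : ∀ x ∈ surfaceOfRevolution Φ s₀ s₁ g, f x = 0 := by
        rintro x ⟨s, -, θ, rfl⟩
        simp only [f, AffineIsometryEquiv.symm_apply_apply]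
        simp
        linear_combination g s ^ 2 * Real.sin_sq_add_cos_sq θ
      refine (hasFDerivWithinAt_const (0 : ℝ) _ _).congr hf0 (hf0 _ ?_)
      rw [surfaceOfRevolution_eq_image]
      exact ⟨p, ⟨hp, mem_univ _⟩, rfl⟩
    have heq := HasFDerivWithinAt.unique_on
      (hfd.hasFDerivWithinAt (s := surfaceOfRevolution Φ s₀ s₁ g)) hz hv
    obtain ⟨u, rfl⟩ : ∃ u, v = L u := ⟨L.symm v, by simp⟩
    have hsymm : Φ.symm.linearIsometryEquiv (L u) = u := by
      change L.symm (L u) = u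
      simp
    -- The kernel condition divided by 2g: the radial component is g' times the axial one.
    have hrad : Real.cos p.2 * u 0 + Real.sin p.2 * u 1 = deriv g p.1 * u 2 := by
      have h2g : (2 * g p.1) ≠ 0 := by positivity
      apply mul_left_cancel₀ h2g
      simp [hsymm, param, er, ez] at heq
      linear_combination heq
    have hu : u = u 2 • (deriv g p.1 • er p.2 + ez)
        + ((-Real.sin p.2 * u 0 + Real.cos p.2 * u 1) / g p.1) • (g p.1 • eth p.2) := by
      rw [smul_smul, div_mul_cancel₀ _ hpos.ne']
      ext i
      fin_cases i
      · simp [er, eth, ez]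
        linear_combination Real.cos p.2 * hrad - u 0 * Real.sin_sq_add_cos_sq p.2
      · simp [er, eth, ez]
        linear_combination Real.sin p.2 * hrad - u 1 * Real.sin_sq_add_cos_sq p.2
      · simp [er, eth, ez]
    rw [SetLike.mem_coe, Submodule.mem_span_pair]
    refine ⟨u 2, (-Real.sin p.2 * u 0 + Real.cos p.2 * u 1) / g p.1, ?_⟩
    conv_rhs => rw [hu]
    simp only [tauS, tauT, map_add, map_smul, L]
  · have hd := (hg.hasFDerivAt_param (Φ := Φ) p).hasFDerivWithinAt (s := Icc s₀ s₁ ×ˢ univ)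
    have hmaps := hd.mapsTo_tangent_cone
    rw [← surfaceOfRevolution_eq_image] at hmaps
    -- The closed strip has a spanning tangent cone even at its edges, and the differential carries
    -- it into the tangent cone of S.
    have hu : UniqueDiffWithinAt ℝ (Icc s₀ s₁ ×ˢ (univ : Set ℝ)) p :=
      ((uniqueDiffOn_Icc hg.lt).prod uniqueDiffOn_univ) p ⟨hp, mem_univ _⟩
    have htop : Submodule.span ℝ (tangentConeAt ℝ (Icc s₀ s₁ ×ˢ (univ : Set ℝ)) p) = ⊤ := by
      have := hu.dense_tangentConeAt
      rw [Submodule.dense_iff_topologicalClosure_eq_top] at this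
      rwa [(Submodule.closed_of_finiteDimensional _).submodule_topologicalClosure_eq] at this
    have hall : ∀ v, paramDeriv Φ g p v ∈
        tangentSpaceAt (surfaceOfRevolution Φ s₀ s₁ g) (param Φ g p) := by
      intro v
      have hle : Submodule.span ℝ (tangentConeAt ℝ (Icc s₀ s₁ ×ˢ (univ : Set ℝ)) p) ≤
          (tangentSpaceAt (surfaceOfRevolution Φ s₀ s₁ g) (param Φ g p)).comap
            (paramDeriv Φ g p).toLinearMap :=
        Submodule.span_le.2 fun w hw => Submodule.subset_span (hmaps hw)
      rw [htop] at hle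
      exact hle (Submodule.mem_top (x := v))
    rw [Submodule.span_le]
    rintro v (rfl | rfl)
    · simpa using hall (1, 0)
    · simpa using hall (0, 1)

/-! ### The tangential projection -/

/-- The orthogonal projection onto the plane of the two coordinate directions. -/
def frameProj (Φ : E3 ≃ᵃⁱ[ℝ] E3) (g : ℝ → ℝ) (p : ℝ × ℝ) : E3 →L[ℝ] E3 :=
  (deriv g p.1 ^ 2 + 1)⁻¹ • (innerSL ℝ (tauS Φ g p)).smulRight (tauS Φ g p) +
    (g p.1 ^ 2)⁻¹ • (innerSL ℝ (tauT Φ g p)).smulRight (tauT Φ g p)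

theorem frameProj_apply (p : ℝ × ℝ) (v : E3) :
    frameProj Φ g p v = ((deriv g p.1 ^ 2 + 1)⁻¹ * ⟪tauS Φ g p, v⟫_ℝ) • tauS Φ g p +
      ((g p.1 ^ 2)⁻¹ * ⟪tauT Φ g p, v⟫_ℝ) • tauT Φ g p := by
  simp [frameProj, smul_smul]

theorem IsProfile.tangentProj_param (hg : IsProfile s₀ s₁ g) {p : ℝ × ℝ} (hp : p.1 ∈ Icc s₀ s₁) :
    tangentProj (surfaceOfRevolution Φ s₀ s₁ g) (param Φ g p) = frameProj Φ g p := by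
  refine ContinuousLinearMap.ext fun v => ?_
  have hpos := hg.pos _ hp
  rw [tangentProj]
  refine Submodule.eq_starProjection_of_mem_of_inner_eq_zero ?_ ?_
  · rw [hg.tangentSpaceAt_param hp, frameProj_apply, Submodule.mem_span_pair]
    exact ⟨_, _, rfl⟩
  · intro w hw
    rw [hg.tangentSpaceAt_param hp, Submodule.mem_span_pair] at hw
    obtain ⟨a, b, rfl⟩ := hw
    have hST := inner_tauS_tauT (Φ := Φ) (g := g) p
    have hTS : ⟪tauT Φ g p, tauS Φ g p⟫_ℝ = 0 := by rw [real_inner_comm, hST]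
    have h1 : deriv g p.1 ^ 2 + 1 ≠ 0 := by positivity
    have h2 : g p.1 ^ 2 ≠ 0 := by positivity
    rw [frameProj_apply]
    simp only [inner_sub_left, inner_add_left, inner_add_right, inner_smul_left, inner_smul_right,
      inner_tauS_tauS, inner_tauT_tauT, hST, hTS, real_inner_comm v]
    simp
    field_simp
    ring

theorem IsProfile.tangentProj_tauS (hg : IsProfile s₀ s₁ g) {p : ℝ × ℝ} (hp : p.1 ∈ Icc s₀ s₁) :
    tangentProj (surfaceOfRevolution Φ s₀ s₁ g) (param Φ g p) (tauS Φ g p) = tauS Φ g p := by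
  refine Submodule.starProjection_eq_self_iff.2 ?_
  rw [hg.tangentSpaceAt_param hp]
  exact Submodule.subset_span (by simp)

theorem IsProfile.tangentProj_tauT (hg : IsProfile s₀ s₁ g) {p : ℝ × ℝ} (hp : p.1 ∈ Icc s₀ s₁) :
    tangentProj (surfaceOfRevolution Φ s₀ s₁ g) (param Φ g p) (tauT Φ g p) = tauT Φ g p := by
  refine Submodule.starProjection_eq_self_iff.2 ?_
  rw [hg.tangentSpaceAt_param hp]
  exact Submodule.subset_span (by simp)

theorem inner_tangentProj_left (S : Set E3) (x u v : E3) :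
    ⟪tangentProj S x u, v⟫_ℝ = ⟪u, tangentProj S x v⟫_ℝ :=
  Submodule.inner_starProjection_left_eq_right _ u v

theorem tangentProj_tangentProj (S : Set E3) (x v : E3) :
    tangentProj S x (tangentProj S x v) = tangentProj S x v :=
  Submodule.starProjection_eq_self_iff.2 (Submodule.starProjection_apply_mem _ v)

theorem norm_tangentProj_le (S : Set E3) (x : E3) : ‖tangentProj S x‖ ≤ 1 :=
  Submodule.starProjection_norm_le _

theorem adjoint_tangentProj (S : Set E3) (x : E3) :
    ContinuousLinearMap.adjoint (tangentProj S x) = tangentProj S x :=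
  (ContinuousLinearMap.eq_adjoint_iff _ _).2 (inner_tangentProj_left S x) |>.symm

/-- A symmetric tangential operator is controlled by its components in the coordinate frame. -/
theorem IsProfile.norm_le_of_tangential (hg : IsProfile s₀ s₁ g) {m : ℝ} (hm : 0 < m)
    {p : ℝ × ℝ} (hp : p.1 ∈ Icc s₀ s₁) (hmp : m ≤ g p.1) {M : E3 →L[ℝ] E3}
    (hM : tangentProj (surfaceOfRevolution Φ s₀ s₁ g) (param Φ g p) ∘L M ∘L
      tangentProj (surfaceOfRevolution Φ s₀ s₁ g) (param Φ g p) = M)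
    (hadj : ContinuousLinearMap.adjoint M = M) :
    ‖M‖ ≤ (1 + m⁻¹) ^ 2 * (|⟪M (tauS Φ g p), tauS Φ g p⟫_ℝ| +
      2 * |⟪M (tauS Φ g p), tauT Φ g p⟫_ℝ| + |⟪M (tauT Φ g p), tauT Φ g p⟫_ℝ|) := by
  set P := tangentProj (surfaceOfRevolution Φ s₀ s₁ g) (param Φ g p) with hP
  have hPf := hg.tangentProj_param (Φ := Φ) hp
  set a := tauS Φ g p
  set b := tauT Φ g p
  have hgp : 0 < g p.1 := hm.trans_le hmp
  have hsym : ⟪M b, a⟫_ℝ = ⟪M a, b⟫_ℝ := by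
    rw [real_inner_comm, ← ContinuousLinearMap.adjoint_inner_left, hadj]
  -- Coefficients of P v in the orthogonal frame are at most ‖v‖/‖a‖ and ‖v‖/‖b‖. Since ‖a‖ ≥ 1 and
  -- ‖b‖ = g ≥ m, the constant 1 + 1/m serves for both.
  have hc1 : ∀ v : E3, |(deriv g p.1 ^ 2 + 1)⁻¹ * ⟪a, v⟫_ℝ| ≤ (1 + m⁻¹) * ‖v‖ := by
    intro v
    have ha : ‖a‖ ^ 2 = deriv g p.1 ^ 2 + 1 := by
      rw [← real_inner_self_eq_norm_sq]; exact inner_tauS_tauS p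
    have ha1 : 1 ≤ ‖a‖ := by
      nlinarith [norm_nonneg a, sq_nonneg (deriv g p.1)]
    rw [← ha, abs_mul, abs_of_pos (by positivity)]
    calc (‖a‖ ^ 2)⁻¹ * |⟪a, v⟫_ℝ| ≤ (‖a‖ ^ 2)⁻¹ * (‖a‖ * ‖v‖) := by
          gcongr; exact abs_real_inner_le_norm a v
      _ = ‖a‖⁻¹ * ‖v‖ := by field_simp
      _ ≤ (1 + m⁻¹) * ‖v‖ := by
          gcongr
          have := inv_le_one_of_one_le₀ ha1
          have : 0 < m⁻¹ := by positivity
          linarith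
  have hc2 : ∀ v : E3, |(g p.1 ^ 2)⁻¹ * ⟪b, v⟫_ℝ| ≤ (1 + m⁻¹) * ‖v‖ := by
    intro v
    have hb : ‖b‖ ^ 2 = g p.1 ^ 2 := by
      rw [← real_inner_self_eq_norm_sq]; exact inner_tauT_tauT p
    have hb1 : ‖b‖ = g p.1 := by
      rwa [pow_left_inj₀ (norm_nonneg _) hgp.le two_ne_zero] at hb
    rw [abs_mul, abs_of_pos (by positivity)]
    calc (g p.1 ^ 2)⁻¹ * |⟪b, v⟫_ℝ| ≤ (g p.1 ^ 2)⁻¹ * (g p.1 * ‖v‖) := by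
          gcongr; rw [← hb1]; exact abs_real_inner_le_norm b v
      _ = (g p.1)⁻¹ * ‖v‖ := by field_simp
      _ ≤ (1 + m⁻¹) * ‖v‖ := by
          gcongr
          have := inv_anti₀ hm hmp
          linarith
  refine ContinuousLinearMap.opNorm_le_of_re_inner_le ?_ ?_
  · positivity
  intro u v hu1 hv1
  have hMuv : ⟪M u, v⟫_ℝ = ⟪M (P u), P v⟫_ℝ := by
    conv_lhs => rw [← hM]
    exact inner_tangentProj_left _ _ _ _
  have hPe : ∀ w, P w = ((deriv g p.1 ^ 2 + 1)⁻¹ * ⟪a, w⟫_ℝ) • a + ((g p.1 ^ 2)⁻¹ * ⟪b, w⟫_ℝ) • b :=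
    fun w => by rw [hP, hPf]; exact frameProj_apply p w
  have hu1' := hc1 u
  have hu2' := hc2 u
  have hv1' := hc1 v
  have hv2' := hc2 v
  rw [hu1, mul_one] at hu1' hu2'
  rw [hv1, mul_one] at hv1' hv2'
  rw [hMuv, hPe u, hPe v]
  generalize (deriv g p.1 ^ 2 + 1)⁻¹ * ⟪a, u⟫_ℝ = α at *
  generalize (g p.1 ^ 2)⁻¹ * ⟪b, u⟫_ℝ = β at *
  generalize (deriv g p.1 ^ 2 + 1)⁻¹ * ⟪a, v⟫_ℝ = γ at *
  generalize (g p.1 ^ 2)⁻¹ * ⟪b, v⟫_ℝ = δ at *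
  have hexp : ⟪M (α • a + β • b), γ • a + δ • b⟫_ℝ
      = α * γ * ⟪M a, a⟫_ℝ + (α * δ * ⟪M a, b⟫_ℝ + β * γ * ⟪M a, b⟫_ℝ) + β * δ * ⟪M b, b⟫_ℝ := by
    simp only [map_add, map_smul, inner_add_left, inner_add_right, inner_smul_left,
      inner_smul_right, hsym]
    simp
    ring
  have hprod : ∀ {c d : ℝ} (t : ℝ), |c| ≤ 1 + m⁻¹ → |d| ≤ 1 + m⁻¹ →
      c * d * t ≤ (1 + m⁻¹) ^ 2 * |t| := by
    intro c d t hc hd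
    calc c * d * t ≤ |c * d * t| := le_abs_self _
      _ = |c| * |d| * |t| := by rw [abs_mul, abs_mul]
      _ ≤ (1 + m⁻¹) * (1 + m⁻¹) * |t| := by gcongr
      _ = _ := by ring
  change ⟪M (α • a + β • b), γ • a + δ • b⟫_ℝ ≤ _
  rw [hexp]
  linarith [hprod ⟪M a, a⟫_ℝ hu1' hv1', hprod ⟪M a, b⟫_ℝ hu1' hv2', hprod ⟪M a, b⟫_ℝ hu2' hv1',
    hprod ⟪M b, b⟫_ℝ hu2' hv2']

/-! ### Comparison of area with Lebesgue measure in the chart -/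

/-- Lebesgue measure on the parameter rectangle. -/
def chartMeasure (s₀ s₁ : ℝ) : Measure (ℝ × ℝ) :=
  (volume.restrict (Ioo s₀ s₁)).prod (volume.restrict (Ioo (-Real.pi) Real.pi))

instance : IsFiniteMeasure (chartMeasure s₀ s₁) := by unfold chartMeasure; infer_instance

theorem chartMeasure_eq :
    chartMeasure s₀ s₁ = volume.restrict (Ioo s₀ s₁ ×ˢ Ioo (-Real.pi) Real.pi) :=
  Measure.prod_restrict _ _

theorem chartMeasure_eq_restrict :
    chartMeasure s₀ s₁ = volume.restrict (Icc s₀ s₁ ×ˢ Ioc (-Real.pi) Real.pi) := by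
  rw [chartMeasure, Measure.restrict_congr_set (Ioo_ae_eq_Icc (a := s₀) (b := s₁)),
    Measure.restrict_congr_set (Ioo_ae_eq_Ioc (a := -Real.pi) (b := Real.pi)),
    Measure.prod_restrict]
  rfl

theorem exists_lipschitzOnWith_of_contDiff {E F : Type*} [NormedAddCommGroup E] [NormedSpace ℝ E]
    [NormedAddCommGroup F] [NormedSpace ℝ F] {f : E → F} (hf : ContDiff ℝ 1 f) {K : Set E}
    (hK : IsCompact K) : ∃ C, LipschitzOnWith C f K :=
  hf.locallyLipschitz.locallyLipschitzOn.exists_lipschitzOnWith_of_compact hK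

theorem IsProfile.exists_le_profile (hg : IsProfile s₀ s₁ g) :
    ∃ m, 0 < m ∧ ∀ s ∈ Icc s₀ s₁, m ≤ g s := by
  obtain ⟨t, ht, hmin⟩ := isCompact_Icc.exists_isMinOn (nonempty_Icc.2 hg.lt.le)
    hg.contDiff.continuous.continuousOn
  exact ⟨g t, hg.pos t ht, fun s hs => hmin hs⟩

/-- The chord has length 2 sin(|θ - θ'|/2), and Jordan's inequality sin x ≥ 2x/π holds on [0, π/2].
-/
theorem abs_sub_le_norm_er_sub {θ θ' : ℝ} (h : |θ - θ'| ≤ Real.pi) :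
    |θ - θ'| ≤ Real.pi / 2 * ‖er θ - er θ'‖ := by
  have h1 : ‖er θ - er θ'‖ ^ 2 = 2 - 2 * Real.cos (θ - θ') := by
    rw [← real_inner_self_eq_norm_sq, inner_sub_left, inner_sub_right, inner_sub_right,
      inner_er_er, inner_er_er, Real.cos_sub]
    simp [er, PiLp.inner_apply, Fin.sum_univ_three]
    ring
  have h2 : ‖er θ - er θ'‖ ^ 2 = (2 * Real.sin (|θ - θ'| / 2)) ^ 2 := by
    rw [h1, ← Real.cos_abs (θ - θ'), mul_pow, Real.sin_sq_eq_half_sub]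
    rw [mul_div_cancel₀ _ (two_ne_zero)]
    ring
  have h3 := Real.mul_le_sin (x := |θ - θ'| / 2) (by positivity) (by linarith)
  have h4 : 0 ≤ Real.sin (|θ - θ'| / 2) := le_trans (by positivity) h3
  rw [pow_left_inj₀ (norm_nonneg _) (by positivity) two_ne_zero] at h2
  rw [h2]
  have hpi := Real.pi_pos
  calc |θ - θ'| = Real.pi / 2 * (2 * (2 / Real.pi * (|θ - θ'| / 2))) := by field_simp
    _ ≤ _ := by gcongr

/-- The standard parametrization has a Lipschitz inverse where angles differ by at most `π`. -/
theorem IsProfile.exists_dist_le_dist_param (hg : IsProfile s₀ s₁ g) :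
    ∃ K : NNReal, ∀ p q : ℝ × ℝ, p.1 ∈ Icc s₀ s₁ → q.1 ∈ Icc s₀ s₁ → |p.2 - q.2| ≤ Real.pi →
      dist p q ≤ K * dist (param Φ g p) (param Φ g q) := by
  obtain ⟨m, hm, hmg⟩ := hg.exists_le_profile
  obtain ⟨C, hC⟩ := exists_lipschitzOnWith_of_contDiff hg.contDiff (isCompact_Icc (a := s₀) (b := s₁))
  have hK : 0 ≤ 1 + Real.pi / 2 * (m⁻¹ * (2 + C)) := by positivity
  refine ⟨⟨1 + Real.pi / 2 * (m⁻¹ * (2 + C)), hK⟩, fun p q hp hq hpq => ?_⟩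
  change _ ≤ (1 + Real.pi / 2 * (m⁻¹ * (2 + C))) * _
  set D := dist (param Φ g p) (param Φ g q) with hD
  have hD0 : 0 ≤ D := dist_nonneg
  have hDn : D = ‖(g p.1 • er p.2 + p.1 • ez) - (g q.1 • er q.2 + q.1 • ez)‖ := by
    rw [hD, param, param, Φ.dist_map, dist_eq_norm]
  have h1 : |p.1 - q.1| ≤ D := by
    rw [hDn]
    have := PiLp.norm_apply_le ((g p.1 • er p.2 + p.1 • ez) - (g q.1 • er q.2 + q.1 • ez)) 2
    simpa [er, ez] using this
  have hez : ‖ez‖ = 1 := by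
    rw [← pow_left_inj₀ (norm_nonneg _) zero_le_one two_ne_zero, ← real_inner_self_eq_norm_sq,
      inner_ez_ez, one_pow]
  have her : ‖er q.2‖ = 1 := by
    rw [← pow_left_inj₀ (norm_nonneg _) zero_le_one two_ne_zero, ← real_inner_self_eq_norm_sq,
      inner_er_er, one_pow]
  -- In 2 + C, one unit is the distance in space, one the axial displacement, and C the Lipschitz
  -- variation of the radius.
  have h2 : m * ‖er p.2 - er q.2‖ ≤ (2 + C) * D := by
    have hgL : |g p.1 - g q.1| ≤ C * |p.1 - q.1| := by
      simpa [Real.dist_eq] using hC.dist_le_mul _ hp _ hq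
    calc m * ‖er p.2 - er q.2‖ ≤ g p.1 * ‖er p.2 - er q.2‖ := by gcongr; exact hmg _ hp
      _ = ‖g p.1 • (er p.2 - er q.2)‖ := by
          rw [norm_smul, Real.norm_eq_abs, abs_of_pos (hg.pos _ hp)]
      _ = ‖((g p.1 • er p.2 + p.1 • ez) - (g q.1 • er q.2 + q.1 • ez)) - (p.1 - q.1) • ez
            - (g p.1 - g q.1) • er q.2‖ := by congr 1; module
      _ ≤ ‖(g p.1 • er p.2 + p.1 • ez) - (g q.1 • er q.2 + q.1 • ez)‖ + ‖(p.1 - q.1) • ez‖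
            + ‖(g p.1 - g q.1) • er q.2‖ := norm_sub_le_of_le (norm_sub_le _ _) le_rfl
      _ ≤ D + D + C * D := by
          rw [← hDn, norm_smul, norm_smul, hez, her, mul_one, mul_one, Real.norm_eq_abs,
            Real.norm_eq_abs]
          gcongr
          exact hgL.trans (by gcongr)
      _ = (2 + C) * D := by ring
  have h3 : |p.2 - q.2| ≤ Real.pi / 2 * (m⁻¹ * (2 + C)) * D := by
    refine (abs_sub_le_norm_er_sub hpq).trans ?_
    rw [mul_assoc, mul_assoc]
    gcongr
    rwa [← mul_le_mul_iff_right₀ hm, mul_inv_cancel_left₀ hm.ne']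
  rw [Prod.dist_eq, Real.dist_eq, Real.dist_eq]
  refine max_le ?_ ?_
  · refine h1.trans ?_
    have : 0 ≤ Real.pi / 2 * (m⁻¹ * (2 + C)) * D := by positivity
    linarith
  · linarith

theorem measurable_param (hg : IsProfile s₀ s₁ g) : Measurable (param Φ g) :=
  hg.contDiff_param.continuous.measurable

/-- A C-Lipschitz map enlarges two-dimensional Hausdorff measure at most by C²; c is the factor
relating it to the Euclidean normalization. -/
theorem IsProfile.exists_area_le (hg : IsProfile s₀ s₁ g) : ∃ K : ℝ≥0∞, K ≠ ⊤ ∧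
    area (surfaceOfRevolution Φ s₀ s₁ g) ≤ K • (chartMeasure s₀ s₁).map (param Φ g) := by
  obtain ⟨C, hC⟩ := exists_lipschitzOnWith_of_contDiff (hg.contDiff_param (Φ := Φ))
    ((isCompact_Icc (a := s₀) (b := s₁)).prod (isCompact_Icc (a := -Real.pi) (b := Real.pi)))
  set c := Measure.addHaarScalarFactor (volume : Measure (EuclideanSpace ℝ (Fin 2))) μH[(2 : ℕ)]
  refine ⟨c * (C : ℝ≥0∞) ^ (2 : ℝ), by finiteness, ?_⟩
  refine Measure.le_iff.2 fun N hN => ?_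
  have hsub : N ∩ surfaceOfRevolution Φ s₀ s₁ g ⊆
      param Φ g '' (param Φ g ⁻¹' N ∩ Icc s₀ s₁ ×ˢ Ioc (-Real.pi) Real.pi) := by
    rw [surfaceOfRevolution_eq_image_Ioc]
    rintro _ ⟨hx, p, hp, rfl⟩
    exact ⟨p, ⟨hx, hp⟩, rfl⟩
  have hC' : LipschitzOnWith C (param Φ g)
      (param Φ g ⁻¹' N ∩ Icc s₀ s₁ ×ˢ Ioc (-Real.pi) Real.pi) :=
    hC.mono (inter_subset_right.trans (prod_mono_right Ioc_subset_Icc_self))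
  rw [area, Measure.restrict_apply hN, Measure.euclideanHausdorffMeasure_def,
    Measure.smul_apply, Measure.smul_apply, Measure.map_apply (measurable_param hg) hN,
    chartMeasure_eq_restrict, Measure.restrict_apply (measurable_param hg hN), smul_eq_mul, mul_assoc]
  change (c : ℝ≥0∞) * _ ≤ _
  gcongr
  refine (measure_mono hsub).trans ((hC'.hausdorffMeasure_image_le (d := (2 : ℕ)) (by simp)).trans ?_)
  -- For the maximum metric of ℝ × ℝ, two-dimensional Hausdorff measure is Lebesgue measure with no
  -- factor.
  rw [← hausdorffMeasure_prod_real]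
  simp

/-- The Lipschitz bound for the inverse needs angles at most π apart, so the period is cut into two
halves; this is the factor 2. -/
theorem IsProfile.exists_map_le (hg : IsProfile s₀ s₁ g) : ∃ K : ℝ≥0∞, K ≠ ⊤ ∧
    (chartMeasure s₀ s₁).map (param Φ g) ≤ K • area (surfaceOfRevolution Φ s₀ s₁ g) := by
  obtain ⟨K, hK⟩ := hg.exists_dist_le_dist_param (Φ := Φ)
  set c := Measure.addHaarScalarFactor (volume : Measure (EuclideanSpace ℝ (Fin 2))) μH[(2 : ℕ)]
  have hc : (c : ℝ≥0∞) ≠ 0 :=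
    ENNReal.coe_ne_zero.2 (Measure.addHaarScalarFactor_volume_hausdorffMeasure_ne_zero 2)
  refine ⟨2 * ((K : ℝ≥0∞) ^ (2 : ℝ) * (c : ℝ≥0∞)⁻¹), by finiteness, ?_⟩
  refine Measure.le_iff.2 fun N hN => ?_
  have hhalf : ∀ V : Set (ℝ × ℝ), V ⊆ Icc s₀ s₁ ×ˢ Ioc (-Real.pi) Real.pi →
      (∀ p ∈ V, ∀ q ∈ V, |p.2 - q.2| ≤ Real.pi) →
      volume (param Φ g ⁻¹' N ∩ V) ≤
        (K : ℝ≥0∞) ^ (2 : ℝ) * (c : ℝ≥0∞)⁻¹ * area (surfaceOfRevolution Φ s₀ s₁ g) N := by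
    intro V hV hVθ
    have hinv : ∀ p ∈ V, coords Φ (param Φ g p) = p := fun p hp =>
      coords_param (hg.pos _ (hV hp).1) (hV hp).2
    have himg : coords Φ '' (param Φ g '' (param Φ g ⁻¹' N ∩ V)) = param Φ g ⁻¹' N ∩ V := by
      rw [image_image]
      exact (image_congr fun p hp => hinv p hp.2).trans (image_id' _)
    have hLip : LipschitzOnWith K (coords Φ) (param Φ g '' (param Φ g ⁻¹' N ∩ V)) := by
      refine LipschitzOnWith.of_dist_le_mul ?_
      rintro _ ⟨p, hp, rfl⟩ _ ⟨q, hq, rfl⟩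
      rw [hinv p hp.2, hinv q hq.2]
      exact hK p q (hV hp.2).1 (hV hq.2).1 (hVθ p hp.2 q hq.2)
    have hsub : param Φ g '' (param Φ g ⁻¹' N ∩ V) ⊆ N ∩ surfaceOfRevolution Φ s₀ s₁ g := by
      rintro _ ⟨p, hp, rfl⟩
      refine ⟨hp.1, ?_⟩
      rw [surfaceOfRevolution_eq_image_Ioc]
      exact ⟨p, hV hp.2, rfl⟩
    rw [area, Measure.restrict_apply hN, Measure.euclideanHausdorffMeasure_def,
      Measure.smul_apply]
    change _ ≤ (K : ℝ≥0∞) ^ (2 : ℝ) * (c : ℝ≥0∞)⁻¹ * ((c : ℝ≥0∞) * _)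
    rw [mul_assoc, ← mul_assoc (c : ℝ≥0∞)⁻¹, ENNReal.inv_mul_cancel hc ENNReal.coe_ne_top, one_mul]
    calc volume (param Φ g ⁻¹' N ∩ V)
        = μH[(2 : ℕ)] (coords Φ '' (param Φ g '' (param Φ g ⁻¹' N ∩ V))) := by
          rw [himg, ← hausdorffMeasure_prod_real]; simp
      _ ≤ (K : ℝ≥0∞) ^ ((2 : ℕ) : ℝ) * μH[(2 : ℕ)] (param Φ g '' (param Φ g ⁻¹' N ∩ V)) :=
          hLip.hausdorffMeasure_image_le (by simp)
      _ ≤ (K : ℝ≥0∞) ^ (2 : ℝ) * μH[(2 : ℕ)] (N ∩ surfaceOfRevolution Φ s₀ s₁ g) := by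
          rw [Nat.cast_two]
          gcongr
  have hcover : Icc s₀ s₁ ×ˢ Ioc (-Real.pi) Real.pi
      ⊆ Icc s₀ s₁ ×ˢ Ioc (-Real.pi) 0 ∪ Icc s₀ s₁ ×ˢ Ioc 0 Real.pi := by
    rintro p ⟨hp, h1, h2⟩
    rcases le_or_gt p.2 0 with h | h
    · exact Or.inl ⟨hp, h1, h⟩
    · exact Or.inr ⟨hp, h, h2⟩
  have hpi := Real.pi_pos
  rw [Measure.smul_apply, Measure.map_apply (measurable_param hg) hN,
    chartMeasure_eq_restrict, Measure.restrict_apply (measurable_param hg hN), smul_eq_mul]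
  calc volume (param Φ g ⁻¹' N ∩ Icc s₀ s₁ ×ˢ Ioc (-Real.pi) Real.pi)
      ≤ volume ((param Φ g ⁻¹' N ∩ Icc s₀ s₁ ×ˢ Ioc (-Real.pi) 0) ∪
          (param Φ g ⁻¹' N ∩ Icc s₀ s₁ ×ˢ Ioc 0 Real.pi)) := by
        rw [← inter_union_distrib_left]
        exact measure_mono (inter_subset_inter_right _ hcover)
    _ ≤ _ + _ := measure_union_le _ _
    _ ≤ _ + _ := by
        refine add_le_add (hhalf _ ?_ ?_) (hhalf _ ?_ ?_)
        · exact prod_mono_right (Ioc_subset_Ioc_right hpi.le)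
        · rintro p ⟨-, hp⟩ q ⟨-, hq⟩
          exact abs_le.2 ⟨by linarith [hp.1, hp.2, hq.1, hq.2], by linarith [hp.1, hp.2, hq.1, hq.2]⟩
        · exact prod_mono_right (Ioc_subset_Ioc_left (by linarith))
        · rintro p ⟨-, hp⟩ q ⟨-, hq⟩
          exact abs_le.2 ⟨by linarith [hp.1, hp.2, hq.1, hq.2], by linarith [hp.1, hp.2, hq.1, hq.2]⟩
    _ = _ := by ring

theorem IsProfile.isFiniteMeasure_area (hg : IsProfile s₀ s₁ g) :
    IsFiniteMeasure (area (surfaceOfRevolution Φ s₀ s₁ g)) := by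
  obtain ⟨K, hK, hle⟩ := hg.exists_area_le (Φ := Φ)
  refine ⟨(hle univ).trans_lt ?_⟩
  rw [Measure.smul_apply, smul_eq_mul]
  exact ENNReal.mul_lt_top hK.lt_top (measure_lt_top _ _)

theorem IsProfile.isCompact_surface (hg : IsProfile s₀ s₁ g) :
    IsCompact (surfaceOfRevolution Φ s₀ s₁ g) := by
  have : surfaceOfRevolution Φ s₀ s₁ g
      = param Φ g '' (Icc s₀ s₁ ×ˢ Icc (-Real.pi) Real.pi) := by
    refine Subset.antisymm ?_ ?_
    · rw [surfaceOfRevolution_eq_image_Ioc]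
      exact image_mono (prod_mono_right Ioc_subset_Icc_self)
    · rw [surfaceOfRevolution_eq_image]
      exact image_mono (prod_mono_right (subset_univ _))
  rw [this]
  exact (isCompact_Icc.prod isCompact_Icc).image hg.contDiff_param.continuous

/-! ### Sobolev embedding on the surface -/

/-- The single chart used for testing weak gradients; it omits only the two boundary circles and one
meridian. -/
theorem IsProfile.isLocalParam (hg : IsProfile s₀ s₁ g) :
    IsLocalParam (surfaceOfRevolution Φ s₀ s₁ g) (Ioo s₀ s₁ ×ˢ Ioo (-Real.pi) Real.pi)
      (param Φ g) where
  isOpen := isOpen_Ioo.prod isOpen_Ioo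
  contDiffOn := by
    have h1 : ContDiffOn ℝ 2 (fun p : ℝ × ℝ => g p.1)
        (Ioo s₀ s₁ ×ˢ Ioo (-Real.pi) Real.pi) :=
      hg.contDiffOn.comp contDiffOn_fst fun p hp => hp.1
    have h2 : ContDiff ℝ 2 (fun p : ℝ × ℝ => er p.2) := contDiff_er.comp contDiff_snd
    have h3 : ContDiff ℝ 2 (fun p : ℝ × ℝ => p.1 • ez) := contDiff_fst.smul contDiff_const
    exact (contDiff_isometryEquiv Φ).comp_contDiffOn ((h1.smul h2.contDiffOn).add h3.contDiffOn)
  injOn := by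
    intro p hp q hq h
    have hpos : ∀ r ∈ Ioo s₀ s₁ ×ˢ Ioo (-Real.pi) Real.pi, coords Φ (param Φ g r) = r :=
      fun r hr => coords_param (hg.pos _ (Ioo_subset_Icc_self hr.1)) (Ioo_subset_Ioc_self hr.2)
    rw [← hpos p hp, ← hpos q hq, h]
  immersion := by
    intro p hp
    rw [(hg.hasFDerivAt_param p).fderiv]
    refine (injective_iff_map_eq_zero _).2 fun v hv => ?_
    have hgp := hg.pos _ (Ioo_subset_Icc_self hp.1)
    rw [paramDeriv_apply] at hv
    have h1 := congrArg (fun x => ⟪x, tauS Φ g p⟫_ℝ) hv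
    have h2 := congrArg (fun x => ⟪x, tauT Φ g p⟫_ℝ) hv
    simp only [inner_add_left, inner_smul_left, inner_tauS_tauS, inner_tauS_tauT, inner_tauT_tauT,
      real_inner_comm (tauS Φ g p) (tauT Φ g p), inner_zero_left] at h1 h2
    have h3 : deriv g p.1 ^ 2 + 1 ≠ 0 := by positivity
    have h4 : g p.1 ^ 2 ≠ 0 := by positivity
    refine Prod.ext ?_ ?_
    · simpa [h3] using h1
    · simpa [hgp.ne'] using h2
  mapsTo := by
    intro p hp
    rw [surfaceOfRevolution_eq_image]
    exact ⟨p, ⟨Ioo_subset_Icc_self hp.1, mem_univ _⟩, rfl⟩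

theorem IsProfile.memLp_comp_param (hg : IsProfile s₀ s₁ g) {E : Type*} [NormedAddCommGroup E]
    {f : E3 → E} {q : ℝ≥0∞} (hf : MemLp f q (area (surfaceOfRevolution Φ s₀ s₁ g))) :
    MemLp (fun p => f (param Φ g p)) q (chartMeasure s₀ s₁) := by
  obtain ⟨K, hK, hle⟩ := hg.exists_map_le (Φ := Φ)
  exact (hf.of_measure_le_smul hK hle).comp_of_map (measurable_param hg).aemeasurable

theorem IsProfile.memLp_of_comp_param (hg : IsProfile s₀ s₁ g) {E : Type*} [NormedAddCommGroup E]
    {f : E3 → E} {q : ℝ≥0∞}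
    (hfm : AEStronglyMeasurable f (area (surfaceOfRevolution Φ s₀ s₁ g)))
    (hf : MemLp (fun p => f (param Φ g p)) q (chartMeasure s₀ s₁)) :
    MemLp f q (area (surfaceOfRevolution Φ s₀ s₁ g)) := by
  obtain ⟨K, hK, hle⟩ := hg.exists_area_le (Φ := Φ)
  obtain ⟨K', hK', hle'⟩ := hg.exists_map_le (Φ := Φ)
  have hac : (chartMeasure s₀ s₁).map (param Φ g) ≪ area (surfaceOfRevolution Φ s₀ s₁ g) :=
    Measure.absolutelyContinuous_of_le_smul hle'
  refine MemLp.of_measure_le_smul hK hle ?_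
  exact (memLp_map_measure_iff (hfm.mono_ac hac) (measurable_param hg).aemeasurable).2 hf

theorem IsTestFunction.tensor_tsupport_subset {I J : Set ℝ} {ζ η : ℝ → ℝ} (hζ : IsTestFunction I ζ)
    (hη : IsTestFunction J η) :
    HasCompactSupport (fun p : ℝ × ℝ => ζ p.1 * η p.2) ∧
      tsupport (fun p : ℝ × ℝ => ζ p.1 * η p.2) ⊆ I ×ˢ J := by
  have hsub : tsupport (fun p : ℝ × ℝ => ζ p.1 * η p.2) ⊆ tsupport ζ ×ˢ tsupport η := by
    refine closure_minimal (fun p hp => ⟨?_, ?_⟩)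
      ((isClosed_tsupport ζ).prod (isClosed_tsupport η))
    · exact subset_tsupport _ (left_ne_zero_of_mul hp)
    · exact subset_tsupport _ (right_ne_zero_of_mul hp)
  refine ⟨?_, hsub.trans (prod_mono hζ.tsupport_subset hη.tsupport_subset)⟩
  exact (hζ.hasCompactSupport.prod hη.hasCompactSupport).of_isClosed_subset (isClosed_tsupport _) hsub

theorem IsTestFunction.fderiv_tensor {I J : Set ℝ} {ζ η : ℝ → ℝ} (hζ : IsTestFunction I ζ)
    (hη : IsTestFunction J η) (p v : ℝ × ℝ) :
    fderiv ℝ (fun p : ℝ × ℝ => ζ p.1 * η p.2) p v =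
      v.1 * (_root_.deriv ζ p.1 * η p.2) + v.2 * (ζ p.1 * _root_.deriv η p.2) := by
  have h1 := ((hζ.contDiff.differentiable (by simp) p.1).hasDerivAt).comp_hasFDerivAt p
    (hasFDerivAt_fst (𝕜 := ℝ) (p := p))
  have h2 := ((hη.contDiff.differentiable (by simp) p.2).hasDerivAt).comp_hasFDerivAt p
    (hasFDerivAt_snd (𝕜 := ℝ) (p := p))
  have h3 : HasFDerivAt (fun p : ℝ × ℝ => ζ p.1 * η p.2) _ p := h1.mul h2
  rw [h3.fderiv]
  simp
  ring

/-- `W^{1,2}` functions on a surface of revolution are in `L⁴`. -/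
theorem IsProfile.memLp_four (hg : IsProfile s₀ s₁ g) {F : Type*} [NormedAddCommGroup F]
    [NormedSpace ℝ F] [CompleteSpace F] {w : E3 → F} {G : E3 → E3 →L[ℝ] F}
    (h : HasWeakGradient (surfaceOfRevolution Φ s₀ s₁ g) w G) :
    MemLp w 4 (area (surfaceOfRevolution Φ s₀ s₁ g)) := by
  refine hg.memLp_of_comp_param h.memLp.1 ?_
  have hG := hg.memLp_comp_param h.memLp_grad
  -- The coordinate derivatives of w in the chart are G applied to the frame, which is bounded on
  -- the compact rectangle.
  have hdir : ∀ τ : ℝ × ℝ → E3, Continuous τ →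
      MemLp (fun p => G (param Φ g p) (τ p)) 2 (chartMeasure s₀ s₁) := by
    intro τ hτ
    obtain ⟨C, hC⟩ := ((isCompact_Icc (a := s₀) (b := s₁)).prod
      (isCompact_Icc (a := -Real.pi) (b := Real.pi))).exists_bound_of_continuousOn hτ.continuousOn
    refine MemLp.of_le_mul (c := C) hG ?_ ?_
    · exact isBoundedBilinearMap_apply.continuous.comp_aestronglyMeasurable
        (hG.1.prodMk hτ.aestronglyMeasurable)
    · rw [chartMeasure_eq_restrict]
      filter_upwards [ae_restrict_mem (measurableSet_Icc.prod measurableSet_Ioc)] with p hp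
      rw [mul_comm]
      exact (G (param Φ g p)).le_opNorm_of_le (hC p ⟨hp.1, Ioc_subset_Icc_self hp.2⟩)
  have hrestr : ∀ (ζ η : ℝ → ℝ) (f : ℝ × ℝ → F), IsTestFunction (Ioo s₀ s₁) ζ →
      IsTestFunction (Ioo (-Real.pi) Real.pi) η →
      ∫ p, (ζ p.1 * η p.2) • f p ∂(chartMeasure s₀ s₁) = ∫ p, (ζ p.1 * η p.2) • f p := by
    intro ζ η f hζ hη
    rw [chartMeasure_eq]
    refine setIntegral_eq_integral_of_forall_compl_eq_zero fun p hp => ?_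
    have : (fun p : ℝ × ℝ => ζ p.1 * η p.2) p = 0 :=
      image_eq_zero_of_notMem_tsupport (f := fun p : ℝ × ℝ => ζ p.1 * η p.2) fun hn =>
        hp ((hζ.tensor_tsupport_subset hη).2 hn)
    rw [show ζ p.1 * η p.2 = 0 from this, zero_smul]
  have hweak : ∀ ζ η, IsTestFunction (Ioo s₀ s₁) ζ → IsTestFunction (Ioo (-Real.pi) Real.pi) η →
      ∀ v : ℝ × ℝ, ∫ p : ℝ × ℝ, (v.1 * (deriv ζ p.1 * η p.2) + v.2 * (ζ p.1 * deriv η p.2)) •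
        w (param Φ g p) = - ∫ p : ℝ × ℝ, (ζ p.1 * η p.2) • G (param Φ g p) (paramDeriv Φ g p v) := by
    intro ζ η hζ hη v
    have := h.weak _ _ hg.isLocalParam (fun p : ℝ × ℝ => ζ p.1 * η p.2)
      ((hζ.contDiff.comp contDiff_fst).mul (hη.contDiff.comp contDiff_snd))
      (hζ.tensor_tsupport_subset hη).1 (hζ.tensor_tsupport_subset hη).2 v
    simp_rw [hζ.fderiv_tensor hη, (hg.hasFDerivAt_param _).fderiv] at this
    exact this
  refine memLp_four_of_weak_derivs hg.lt (by linarith [Real.pi_pos]) (hg.memLp_comp_param h.memLp)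
    (hdir _ (hg.continuous_tauS (Φ := Φ))) (hdir _ (hg.continuous_tauT (Φ := Φ))) ?_ ?_
  · intro ζ η hζ hη
    refine (hrestr (deriv ζ) η _ hζ.deriv hη).trans
      (Eq.trans ?_ (congrArg _ (hrestr ζ η _ hζ hη).symm))
    simpa using hweak ζ η hζ hη (1, 0)
  · intro ζ η hζ hη
    refine (hrestr ζ (deriv η) _ hζ hη.deriv).trans
      (Eq.trans ?_ (congrArg _ (hrestr ζ η _ hζ hη).symm))
    simpa using hweak ζ η hζ hη (0, 1)

/-! ### Fields of class `C¹` near the surface -/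

theorem integrable_smul_of_tsupport_subset {F : Type*} [NormedAddCommGroup F] [NormedSpace ℝ F]
    {U : Set (ℝ × ℝ)} (hU : IsOpen U) {ρ : ℝ × ℝ → ℝ} {f : ℝ × ℝ → F} (hρ : Continuous ρ)
    (hc : HasCompactSupport ρ) (hs : tsupport ρ ⊆ U) (hf : ContinuousOn f U) :
    Integrable (fun y => ρ y • f y) := by
  have hsub : tsupport (fun y => ρ y • f y) ⊆ tsupport ρ :=
    closure_mono fun y hy => left_ne_zero_of_smul hy
  refine Continuous.integrable_of_hasCompactSupport (continuous_of_tsupport fun y hy => ?_)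
    (hc.of_isClosed_subset (isClosed_tsupport _) hsub)
  exact hρ.continuousAt.smul (hf.continuousAt (hU.mem_nhds (hs (hsub hy))))

theorem memLp_of_continuousOn_isCompact {E : Type*} [NormedAddCommGroup E]
    {S : Set E3} (hS : IsCompact S) [IsFiniteMeasure (area S)] {f : E3 → E}
    (hf : ContinuousOn f S) {q : ℝ≥0∞} : MemLp f q (area S) := by
  obtain ⟨C, hC⟩ := hS.exists_bound_of_continuousOn hf
  refine MemLp.of_bound (hf.aestronglyMeasurable_of_isCompact hS hS.measurableSet) C ?_
  exact (ae_restrict_mem hS.measurableSet).mono hC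

/-- A function of class `C¹` near a compact surface of finite area is a Sobolev function on it, with
the classical derivative as its weak gradient. -/
theorem hasWeakGradient_of_contDiffAt {F : Type*} [NormedAddCommGroup F] [NormedSpace ℝ F]
    {S : Set E3} (hS : IsCompact S) [IsFiniteMeasure (area S)] {W : E3 → F}
    (hW : ∀ x ∈ S, ContDiffAt ℝ 1 W x) : HasWeakGradient S W (fderiv ℝ W) := by
  have hd : ∀ x ∈ S, ContinuousAt (fderiv ℝ W) x := fun x hx =>
    ((hW x hx).fderiv_right (m := 0) (by simp)).continuousAt
  refine ⟨memLp_of_continuousOn_isCompact hS fun x hx => (hW x hx).continuousAt.continuousWithinAt,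
    memLp_of_continuousOn_isCompact hS fun x hx => (hd x hx).continuousWithinAt, ?_⟩
  intro U ψ hψ φ hφ hφc hφs v
  have hψd : ∀ y ∈ U, ContDiffAt ℝ 2 ψ y := fun y hy =>
    hψ.contDiffOn.contDiffAt (hψ.isOpen.mem_nhds hy)
  have hdiff : ∀ y ∈ U, HasFDerivAt (fun y => W (ψ y)) (fderiv ℝ W (ψ y) ∘L fderiv ℝ ψ y) y := by
    intro y hy
    exact ((hW _ (hψ.mapsTo hy)).differentiableAt one_ne_zero).hasFDerivAt.comp y
      ((hψd y hy).differentiableAt two_ne_zero).hasFDerivAt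
  have hcont : ContinuousOn (fun y => W (ψ y)) U := fun y hy =>
    (hdiff y hy).continuousAt.continuousWithinAt
  have hcont' : ContinuousOn (fun y => fderiv ℝ W (ψ y) (fderiv ℝ ψ y v)) U := by
    intro y hy
    have h1 : ContinuousAt (fun y => fderiv ℝ W (ψ y)) y :=
      (hd _ (hψ.mapsTo hy)).comp (hψd y hy).continuousAt
    have h2 : ContinuousAt (fun y => fderiv ℝ ψ y v) y :=
      ((hψd y hy).fderiv_right (m := 0) (by norm_num)).continuousAt.clm_apply continuousAt_const
    exact (h1.clm_apply h2).continuousWithinAt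
  have hφ' : Continuous fun y => fderiv ℝ φ y v :=
    (hφ.continuous_fderiv (by simp)).clm_apply continuous_const
  have hφc' : HasCompactSupport fun y => fderiv ℝ φ y v := hφc.fderiv_apply (𝕜 := ℝ) v
  -- The chain rule is available only on U; elsewhere φ vanishes.
  have heq : ∀ y, φ y • fderiv ℝ (fun y => W (ψ y)) y v
      = φ y • fderiv ℝ W (ψ y) (fderiv ℝ ψ y v) := by
    intro y
    by_cases hy : y ∈ tsupport φ
    · rw [(hdiff y (hφs hy)).fderiv]; rfl
    · rw [image_eq_zero_of_notMem_tsupport hy, zero_smul, zero_smul]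
  have key := integral_smul_fderiv_eq_neg_fderiv_smul_of_integrable (μ := volume)
    (f := φ) (g := fun y => W (ψ y)) (v := v)
    (integrable_smul_of_tsupport_subset hψ.isOpen hφ' hφc'
      ((tsupport_fderiv_apply_subset ℝ v).trans hφs) hcont)
    (by
      simp_rw [heq]
      exact integrable_smul_of_tsupport_subset hψ.isOpen hφ.continuous hφc hφs hcont')
    (integrable_smul_of_tsupport_subset hψ.isOpen hφ.continuous hφc hφs hcont)
    (fun y _ => hφ.differentiable (by simp) y)
    (fun y hy => (hdiff y (hφs hy)).differentiableAt)
  simp_rw [heq] at key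
  rw [key, neg_neg]

/-! ### Measurability of the tangential projection -/

theorem IsProfile.param_coords (hg : IsProfile s₀ s₁ g) {x : E3}
    (hx : x ∈ surfaceOfRevolution Φ s₀ s₁ g) :
    param Φ g (coords Φ x) = x ∧ (coords Φ x).1 ∈ Icc s₀ s₁ := by
  rw [surfaceOfRevolution_eq_image_Ioc] at hx
  obtain ⟨p, hp, rfl⟩ := hx
  rw [coords_param (hg.pos _ hp.1) hp.2]
  exact ⟨rfl, hp.1⟩

theorem IsProfile.ae_mem_surface (hg : IsProfile s₀ s₁ g) :
    ∀ᵐ x ∂area (surfaceOfRevolution Φ s₀ s₁ g), x ∈ surfaceOfRevolution Φ s₀ s₁ g :=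
  ae_restrict_mem hg.isCompact_surface.measurableSet

theorem IsProfile.stronglyMeasurable_frameProj (hg : IsProfile s₀ s₁ g) :
    StronglyMeasurable (frameProj Φ g) := by
  have hgm : Measurable fun p : ℝ × ℝ => (g p.1 ^ 2)⁻¹ :=
    ((hg.contDiff.continuous.comp continuous_fst).pow 2).measurable.inv
  have hdm : Measurable fun p : ℝ × ℝ => (deriv g p.1 ^ 2 + 1)⁻¹ :=
    (((hg.continuous_deriv.comp continuous_fst).pow 2).add continuous_const).measurable.inv
  have hT : ∀ τ : ℝ × ℝ → E3, Continuous τ →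
      Continuous fun p => (innerSL ℝ (τ p)).smulRight (τ p) := by
    intro τ hτ
    have := hτ
    fun_prop
  exact (hdm.stronglyMeasurable.smul (hT _ hg.continuous_tauS).stronglyMeasurable).add
    (hgm.stronglyMeasurable.smul (hT _ hg.continuous_tauT).stronglyMeasurable)

/-- On S the projection has the explicit formula `frameProj` in the coordinates of the point. -/
theorem IsProfile.aestronglyMeasurable_tangentProj (hg : IsProfile s₀ s₁ g) :
    AEStronglyMeasurable (tangentProj (surfaceOfRevolution Φ s₀ s₁ g))
      (area (surfaceOfRevolution Φ s₀ s₁ g)) := by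
  refine ⟨fun x => frameProj Φ g (coords Φ x),
    hg.stronglyMeasurable_frameProj.comp_measurable measurable_coords, ?_⟩
  filter_upwards [hg.ae_mem_surface] with x hx
  obtain ⟨h1, h2⟩ := hg.param_coords hx
  conv_lhs => rw [← h1]
  exact hg.tangentProj_param h2

theorem IsProfile.aestronglyMeasurable_tan (hg : IsProfile s₀ s₁ g) {A : E3 → E3 →L[ℝ] E3}
    (hA : AEStronglyMeasurable A (area (surfaceOfRevolution Φ s₀ s₁ g))) :
    AEStronglyMeasurable (tan (surfaceOfRevolution Φ s₀ s₁ g) A)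
      (area (surfaceOfRevolution Φ s₀ s₁ g)) := by
  have hP := hg.aestronglyMeasurable_tangentProj (Φ := Φ)
  have hcomp : Continuous fun q : (E3 →L[ℝ] E3) × (E3 →L[ℝ] E3) => q.1 ∘L q.2 := by fun_prop
  exact hcomp.comp_aestronglyMeasurable
    (hP.prodMk (hcomp.comp_aestronglyMeasurable (hA.prodMk hP)))

theorem norm_tan_le (S : Set E3) (A : E3 → E3 →L[ℝ] E3) (x : E3) : ‖tan S A x‖ ≤ ‖A x‖ := by
  have hP := norm_tangentProj_le S x
  calc ‖tan S A x‖ ≤ ‖tangentProj S x‖ * (‖A x‖ * ‖tangentProj S x‖) :=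
        (ContinuousLinearMap.opNorm_comp_le _ _).trans (mul_le_mul_of_nonneg_left
          (ContinuousLinearMap.opNorm_comp_le _ _) (norm_nonneg _))
    _ ≤ 1 * (‖A x‖ * 1) := by gcongr
    _ = ‖A x‖ := by ring

theorem IsProfile.memLp_tan (hg : IsProfile s₀ s₁ g) {A : E3 → E3 →L[ℝ] E3} {q : ℝ≥0∞}
    (hA : MemLp A q (area (surfaceOfRevolution Φ s₀ s₁ g))) :
    MemLp (tan (surfaceOfRevolution Φ s₀ s₁ g) A) q (area (surfaceOfRevolution Φ s₀ s₁ g)) :=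
  hA.mono (hg.aestronglyMeasurable_tan hA.1) (ae_of_all _ (norm_tan_le _ A))

theorem continuous_adjoint :
    Continuous fun M : E3 →L[ℝ] E3 => ContinuousLinearMap.adjoint M :=
  (ContinuousLinearMap.adjoint (𝕜 := ℝ) (E := E3) (F := E3)).continuous

theorem norm_symmetrization_le (M : E3 →L[ℝ] E3) :
    ‖(1 / 2 : ℝ) • (M + ContinuousLinearMap.adjoint M)‖ ≤ ‖M‖ := by
  have h1 : ‖M + ContinuousLinearMap.adjoint M‖ ≤ ‖M‖ + ‖M‖ :=
    (norm_add_le _ _).trans_eq (by rw [LinearIsometryEquiv.norm_map])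
  rw [norm_smul]
  norm_num
  linarith

theorem IsProfile.memLp_symGrad (hg : IsProfile s₀ s₁ g) {A : E3 → E3 →L[ℝ] E3} {q : ℝ≥0∞}
    (hA : MemLp A q (area (surfaceOfRevolution Φ s₀ s₁ g))) :
    MemLp (symGrad (surfaceOfRevolution Φ s₀ s₁ g) A) q
      (area (surfaceOfRevolution Φ s₀ s₁ g)) := by
  have ht := hg.memLp_tan hA
  have hc : Continuous fun M : E3 →L[ℝ] E3 =>
      (1 / 2 : ℝ) • (M + ContinuousLinearMap.adjoint M) := by
    have := continuous_adjoint
    fun_prop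
  exact ht.mono (hc.comp_aestronglyMeasurable ht.1)
    (ae_of_all _ fun x => norm_symmetrization_le (tan (surfaceOfRevolution Φ s₀ s₁ g) A x))

/-! ### Symmetric tangential operators -/

theorem tan_tan (S : Set E3) (A : E3 → E3 →L[ℝ] E3) (x : E3) : tan S (tan S A) x = tan S A x := by
  ext1 v
  simp [tan, tangentProj_tangentProj]

theorem adjoint_tan (S : Set E3) (A : E3 → E3 →L[ℝ] E3) (x : E3) :
    ContinuousLinearMap.adjoint (tan S A x) =
      tangentProj S x ∘L ContinuousLinearMap.adjoint (A x) ∘L tangentProj S x := by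
  rw [tan, ContinuousLinearMap.adjoint_comp, ContinuousLinearMap.adjoint_comp, adjoint_tangentProj,
    ContinuousLinearMap.comp_assoc]

theorem tan_symGrad (S : Set E3) (A : E3 → E3 →L[ℝ] E3) (x : E3) :
    tangentProj S x ∘L symGrad S A x ∘L tangentProj S x = symGrad S A x := by
  rw [symGrad, adjoint_tan]
  ext1 v
  simp [tan, tangentProj_tangentProj]

theorem adjoint_symGrad (S : Set E3) (A : E3 → E3 →L[ℝ] E3) (x : E3) :
    ContinuousLinearMap.adjoint (symGrad S A x) = symGrad S A x := by
  rw [symGrad, map_smulₛₗ, map_add, ContinuousLinearMap.adjoint_adjoint, add_comm]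
  simp

theorem inner_symGrad (S : Set E3) (A : E3 → E3 →L[ℝ] E3) {x τ η : E3}
    (hτ : tangentProj S x τ = τ) (hη : tangentProj S x η = η) :
    ⟪symGrad S A x τ, η⟫_ℝ = (1 / 2 : ℝ) * (⟪A x τ, η⟫_ℝ + ⟪A x η, τ⟫_ℝ) := by
  have h1 : ∀ {a b : E3}, tangentProj S x a = a → tangentProj S x b = b →
      ⟪tan S A x a, b⟫_ℝ = ⟪A x a, b⟫_ℝ := by
    intro a b ha hb
    simp only [tan, ContinuousLinearMap.comp_apply]
    rw [inner_tangentProj_left, ha, hb]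
  rw [symGrad, smul_apply, add_apply, inner_smul_left, inner_add_left,
    ContinuousLinearMap.adjoint_inner_left, h1 hτ hη, real_inner_comm (tan S A x η) τ, h1 hη hτ]
  simp

/-! ### Strains of smooth periodic displacements -/

/-- `(e₁, e₂, e₃)` are the components, in the coordinate frame, of the strain of a `C¹`
displacement of the surface. -/
def IsStrain (Φ : E3 ≃ᵃⁱ[ℝ] E3) (s₀ s₁ : ℝ) (g : ℝ → ℝ) (e₁ e₂ e₃ : ℝ × ℝ → ℝ) : Prop :=
  ∃ w : ℝ × ℝ → E3, ContDiff ℝ 1 w ∧ AnglePeriodic w ∧ ∀ p : ℝ × ℝ, p.1 ∈ Icc s₀ s₁ →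
    ⟪fderiv ℝ w p (1, 0), tauS Φ g p⟫_ℝ = e₁ p ∧
    ⟪fderiv ℝ w p (1, 0), tauT Φ g p⟫_ℝ + ⟪fderiv ℝ w p (0, 1), tauS Φ g p⟫_ℝ = 2 * e₂ p ∧
    ⟪fderiv ℝ w p (0, 1), tauT Φ g p⟫_ℝ = e₃ p

theorem IsStrain.add {e₁ e₂ e₃ e₁' e₂' e₃' : ℝ × ℝ → ℝ} (h : IsStrain Φ s₀ s₁ g e₁ e₂ e₃)
    (h' : IsStrain Φ s₀ s₁ g e₁' e₂' e₃') :
    IsStrain Φ s₀ s₁ g (e₁ + e₁') (e₂ + e₂') (e₃ + e₃') := by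
  obtain ⟨w, hw, hp, h⟩ := h
  obtain ⟨w', hw', hp', h'⟩ := h'
  refine ⟨w + w', hw.add hw', fun s θ => ?_, fun p hps => ?_⟩
  · rw [Pi.add_apply, Pi.add_apply, hp, hp']
  · obtain ⟨h1, h2, h3⟩ := h p hps
    obtain ⟨h1', h2', h3'⟩ := h' p hps
    rw [fderiv_add (hw.differentiable one_ne_zero p) (hw'.differentiable one_ne_zero p)]
    simp only [add_apply, inner_add_left, Pi.add_apply]
    exact ⟨by linarith, by linarith, by linarith⟩

theorem IsStrain.smul {e₁ e₂ e₃ : ℝ × ℝ → ℝ} (c : ℝ) (h : IsStrain Φ s₀ s₁ g e₁ e₂ e₃) :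
    IsStrain Φ s₀ s₁ g (c • e₁) (c • e₂) (c • e₃) := by
  obtain ⟨w, hw, hp, h⟩ := h
  refine ⟨c • w, contDiff_const.smul hw, fun s θ => ?_, fun p hps => ?_⟩
  · rw [Pi.smul_apply, Pi.smul_apply, hp]
  · obtain ⟨h1, h2, h3⟩ := h p hps
    rw [fderiv_const_smul (hw.differentiable one_ne_zero p)]
    simp only [smul_apply, inner_smul_left, Pi.smul_apply, smul_eq_mul, h1, h3]
    refine ⟨by simp, ?_, by simp⟩
    simp
    linear_combination c * h2

theorem isStrain_zero : IsStrain Φ s₀ s₁ g 0 0 0 := by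
  refine ⟨0, contDiff_const, fun s θ => rfl, fun p _ => ?_⟩
  have : fderiv ℝ (0 : ℝ × ℝ → E3) p = 0 := fderiv_const_apply 0
  simp [this]

theorem IsProfile.offAxis (hg : IsProfile s₀ s₁ g) {x : E3}
    (hx : x ∈ surfaceOfRevolution Φ s₀ s₁ g) : (⟨Φ.symm x 0, Φ.symm x 1⟩ : ℂ) ≠ 0 := by
  obtain ⟨s, hs, θ, rfl⟩ := hx
  intro h
  have h0 := congrArg Complex.re h
  have h1 := congrArg Complex.im h
  have hpos := hg.pos s hs
  simp [hpos.ne'] at h0 h1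
  have := Real.sin_sq_add_cos_sq θ
  rw [h0, h1] at this
  norm_num at this

/-- The displacement of the surface with prescribed strain components. -/
theorem IsStrain.exists_hasWeakGradient (hg : IsProfile s₀ s₁ g) {e₁ e₂ e₃ : ℝ × ℝ → ℝ}
    (h : IsStrain Φ s₀ s₁ g e₁ e₂ e₃) :
    ∃ (W : E3 → E3) (G : E3 → E3 →L[ℝ] E3),
      HasWeakGradient (surfaceOfRevolution Φ s₀ s₁ g) W G ∧
      ∀ p : ℝ × ℝ, p.1 ∈ Icc s₀ s₁ →
        ⟪symGrad (surfaceOfRevolution Φ s₀ s₁ g) G (param Φ g p) (tauS Φ g p), tauS Φ g p⟫_ℝ = e₁ p ∧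
        ⟪symGrad (surfaceOfRevolution Φ s₀ s₁ g) G (param Φ g p) (tauS Φ g p), tauT Φ g p⟫_ℝ = e₂ p ∧
        ⟪symGrad (surfaceOfRevolution Φ s₀ s₁ g) G (param Φ g p) (tauT Φ g p), tauT Φ g p⟫_ℝ
          = e₃ p := by
  obtain ⟨w, hw, hp, h⟩ := h
  have := hg.isFiniteMeasure_area (Φ := Φ)
  have hW : ∀ x ∈ surfaceOfRevolution Φ s₀ s₁ g, ContDiffAt ℝ 1 (fun x => w (coords Φ x)) x :=
    fun x hx => hp.contDiffAt_comp_coords hw (hg.offAxis hx)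
  refine ⟨fun x => w (coords Φ x), fderiv ℝ fun x => w (coords Φ x),
    hasWeakGradient_of_contDiffAt hg.isCompact_surface hW, fun p hps => ?_⟩
  have hmem : param Φ g p ∈ surfaceOfRevolution Φ s₀ s₁ g := by
    rw [surfaceOfRevolution_eq_image]
    exact ⟨p, ⟨hps, mem_univ _⟩, rfl⟩
  have hchain : ∀ v, fderiv ℝ (fun x => w (coords Φ x)) (param Φ g p) (paramDeriv Φ g p v)
      = fderiv ℝ w p v := by
    intro v
    have h1 := ((hW _ hmem).differentiableAt one_ne_zero).hasFDerivAt.comp p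
      (hg.hasFDerivAt_param (Φ := Φ) p)
    -- W ∘ `param` must agree with w on a full neighbourhood of p, also when p is on the edge of the
    -- strip; positivity of g there is enough.
    have hopen : ∀ᶠ q : ℝ × ℝ in 𝓝 p, 0 < g q.1 :=
      (hg.contDiff.continuous.comp continuous_fst).continuousAt.eventually
        (lt_mem_nhds (hg.pos _ hps))
    have h2 : HasFDerivAt w _ p := h1.congr_of_eventuallyEq
      (hopen.mono fun q hq => (hp.comp_coords_param hq).symm)
    rw [h2.fderiv]
    rfl
  have hS := hchain (1, 0)
  have hT := hchain (0, 1)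
  simp only [paramDeriv_apply, one_smul, zero_smul, add_zero, zero_add] at hS hT
  obtain ⟨h1, h2, h3⟩ := h p hps
  have hPS := hg.tangentProj_tauS (Φ := Φ) hps
  have hPT := hg.tangentProj_tauT (Φ := Φ) hps
  rw [inner_symGrad _ _ hPS hPS, inner_symGrad _ _ hPS hPT, inner_symGrad _ _ hPT hPT, hS, hT, h1,
    h2, h3]
  exact ⟨by ring, by ring, by ring⟩

theorem fderiv_apply_eq_of_hasDerivAt {F : Type*} [NormedAddCommGroup F] [NormedSpace ℝ F]
    {w : ℝ × ℝ → F} {p : ℝ × ℝ} (hw : DifferentiableAt ℝ w p) {d₁ d₂ : F}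
    (h₁ : HasDerivAt (fun s => w (s, p.2)) d₁ p.1) (h₂ : HasDerivAt (fun θ => w (p.1, θ)) d₂ p.2) :
    fderiv ℝ w p (1, 0) = d₁ ∧ fderiv ℝ w p (0, 1) = d₂ := by
  constructor
  · have := hw.hasFDerivAt.comp_hasDerivAt p.1
      ((hasDerivAt_id p.1).prodMk (hasDerivAt_const p.1 p.2))
    exact this.unique h₁
  · have := hw.hasFDerivAt.comp_hasDerivAt p.2
      ((hasDerivAt_const p.2 p.1).prodMk (hasDerivAt_id p.2))
    exact this.unique h₂

/-- The reciprocal of the profile, extended to a `C¹` function on the line. -/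
theorem IsProfile.exists_reciprocal (hg : IsProfile s₀ s₁ g) :
    ∃ ρ : ℝ → ℝ, ContDiff ℝ 1 ρ ∧ ∀ t ∈ Icc s₀ s₁, ρ t * g t = 1 := by
  -- g is positive only on the closed interval, so 1/g is extended from there.
  obtain ⟨ρ, hρ, h⟩ := exists_contDiff_extension (f := fun t => (g t)⁻¹)
    (f' := fun t => -deriv g t / g t ^ 2) hg.lt.le
    (fun t ht => ((hg.contDiff.differentiable one_ne_zero t).hasDerivAt.inv
      (hg.pos t ht).ne').hasDerivWithinAt)
    (hg.continuous_deriv.neg.continuousOn.div (hg.contDiff.continuous.pow 2).continuousOn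
      fun t ht => pow_ne_zero 2 (hg.pos t ht).ne')
  exact ⟨ρ, hρ, fun t ht => by rw [(h t ht).1, inv_mul_cancel₀ (hg.pos t ht).ne']⟩

/-- Solvability of the system for the profiles `b`, `c` of the angular and axial displacements in a
Fourier mode. -/
theorem IsProfile.exists_mode_profiles (hg : IsProfile s₀ s₁ g) {p₁ p₂ γ ρ : ℝ → ℝ}
    (h₁ : ContDiff ℝ 1 p₁) (h₂ : ContDiff ℝ 1 p₂) (hγ : ContDiff ℝ 1 γ) (hρ : ContDiff ℝ 1 ρ)
    (k : ℝ) :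
    ∃ b c : ℝ → ℝ, ContDiff ℝ 1 b ∧ ContDiff ℝ 1 c ∧ ∀ t ∈ Icc s₀ s₁,
      deriv b t = ρ t * (2 * p₂ t + deriv g t * (k * γ t + (1 - k ^ 2) * b t) + k * c t) ∧
      deriv c t = p₁ t - deriv g t * deriv γ t + k * deriv g t * deriv b t := by
  set E₁₁ : ℝ × ℝ →L[ℝ] ℝ × ℝ := (ContinuousLinearMap.fst ℝ ℝ ℝ).prod 0
  set E₁₂ : ℝ × ℝ →L[ℝ] ℝ × ℝ := (ContinuousLinearMap.snd ℝ ℝ ℝ).prod 0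
  set E₂₁ : ℝ × ℝ →L[ℝ] ℝ × ℝ := ContinuousLinearMap.prod 0 (ContinuousLinearMap.fst ℝ ℝ ℝ)
  set E₂₂ : ℝ × ℝ →L[ℝ] ℝ × ℝ := ContinuousLinearMap.prod 0 (ContinuousLinearMap.snd ℝ ℝ ℝ)
  have c1 := h₁.continuous
  have c2 := h₂.continuous
  have c3 := hγ.continuous
  have c4 := hρ.continuous
  have c5 := hg.continuous_deriv
  have c6 : Continuous (deriv γ) := hγ.continuous_deriv le_rfl
  -- The equation for c' contains b'; substituting the equation for b' brings the system to the
  -- explicit form x' = A x + h.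
  set A : ℝ → ℝ × ℝ →L[ℝ] ℝ × ℝ := fun t =>
    (ρ t * (deriv g t * (1 - k ^ 2))) • E₁₁ + (ρ t * k) • E₁₂ +
      (k * deriv g t * (ρ t * (deriv g t * (1 - k ^ 2)))) • E₂₁ +
      (k * deriv g t * (ρ t * k)) • E₂₂ with hA
  set h : ℝ → ℝ × ℝ := fun t => (ρ t * (2 * p₂ t + deriv g t * (k * γ t)),
    p₁ t - deriv g t * deriv γ t + k * deriv g t * (ρ t * (2 * p₂ t + deriv g t * (k * γ t)))) with hh
  have hAc : Continuous A := by fun_prop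
  have hhc : Continuous h := by fun_prop
  obtain ⟨x, hx⟩ := exists_solution_linear_system hg.lt.le hAc hhc
  have hxc : ContinuousOn x (Icc s₀ s₁) := fun t ht => (hx t ht).continuousWithinAt
  obtain ⟨X, hX, hXx⟩ := exists_contDiff_extension hg.lt.le hx
    ((hAc.continuousOn.clm_apply hxc).add hhc.continuousOn)
  refine ⟨fun t => (X t).1, fun t => (X t).2, contDiff_fst.comp hX, contDiff_snd.comp hX,
    fun t ht => ?_⟩
  obtain ⟨hXt, hXd⟩ := hXx t ht
  have hd := (hX.differentiable one_ne_zero t).hasDerivAt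
  have hd1 : deriv (fun t => (X t).1) t = (deriv X t).1 :=
    ((ContinuousLinearMap.fst ℝ ℝ ℝ).hasFDerivAt.comp_hasDerivAt t hd).deriv
  have hd2 : deriv (fun t => (X t).2) t = (deriv X t).2 :=
    ((ContinuousLinearMap.snd ℝ ℝ ℝ).hasFDerivAt.comp_hasDerivAt t hd).deriv
  rw [hd1, hd2, hXd]
  simp [hXt, hA, hh, E₁₁, E₁₂, E₂₁, E₂₂]
  constructor <;> ring

/-- Every Fourier mode with `C¹` coefficients is a strain. -/
theorem IsProfile.isStrain_mode (hg : IsProfile s₀ s₁ g) {p₁ p₂ p₃ : ℝ → ℝ} (h₁ : ContDiff ℝ 1 p₁)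
    (h₂ : ContDiff ℝ 1 p₂) (h₃ : ContDiff ℝ 1 p₃) (k : ℤ) (φ : ℝ) :
    IsStrain Φ s₀ s₁ g (fun p => p₁ p.1 * Real.cos (k * p.2 + φ))
      (fun p => p₂ p.1 * Real.sin (k * p.2 + φ)) (fun p => p₃ p.1 * Real.cos (k * p.2 + φ)) := by
  obtain ⟨ρ, hρ, hρg⟩ := hg.exists_reciprocal
  have hγ : ContDiff ℝ 1 fun t => ρ t * p₃ t := hρ.mul h₃
  obtain ⟨b, c, hb, hc, hbc⟩ := hg.exists_mode_profiles h₁ h₂ hγ hρ k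
  set γ : ℝ → ℝ := fun t => ρ t * p₃ t
  -- The hoop equation g (a + k b) = p₃ solved for a, with γ = p₃/g.
  set a : ℝ → ℝ := fun t => γ t - k * b t with ha_def
  have ha : ContDiff ℝ 1 a := hγ.sub (contDiff_const.mul hb)
  set L := Φ.linearIsometryEquiv
  set w : ℝ × ℝ → E3 := fun p => L ((a p.1 * Real.cos (k * p.2 + φ)) • er p.2 +
    (b p.1 * Real.sin (k * p.2 + φ)) • eth p.2 + (c p.1 * Real.cos (k * p.2 + φ)) • ez) with hw_def
  have hw : ContDiff ℝ 1 w := by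
    have hang : ContDiff ℝ 1 fun p : ℝ × ℝ => (k : ℝ) * p.2 + φ :=
      (contDiff_const.mul contDiff_snd).add contDiff_const
    refine L.contDiff.comp ((ContDiff.add ?_ ?_).add ?_)
    · exact ((ha.comp contDiff_fst).mul hang.cos).smul (contDiff_er.comp contDiff_snd)
    · exact ((hb.comp contDiff_fst).mul hang.sin).smul (contDiff_eth.comp contDiff_snd)
    · exact ((hc.comp contDiff_fst).mul hang.cos).smul contDiff_const
  refine ⟨w, hw, fun s θ => ?_, fun p hp => ?_⟩
  · have h1 : (k : ℝ) * (θ + 2 * Real.pi) + φ = (k * θ + φ) + k * (2 * Real.pi) := by ring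
    simp only [hw_def, h1, Real.cos_add_int_mul_two_pi, Real.sin_add_int_mul_two_pi, er, eth,
      Real.cos_add_two_pi, Real.sin_add_two_pi]
  · obtain ⟨s, θ⟩ := p
    change s ∈ Icc s₀ s₁ at hp
    have hDa := (ha.differentiable one_ne_zero s).hasDerivAt
    have hDb := (hb.differentiable one_ne_zero s).hasDerivAt
    have hDc := (hc.differentiable one_ne_zero s).hasDerivAt
    have hang : HasDerivAt (fun θ : ℝ => (k : ℝ) * θ + φ) k θ := by
      simpa using ((hasDerivAt_id θ).const_mul (k : ℝ)).add_const φ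
    have hLd : ∀ {f : ℝ → E3} {f' : E3} {t : ℝ}, HasDerivAt f f' t →
        HasDerivAt (fun t => L (f t)) (L f') t := fun hf =>
      (L.toContinuousLinearEquiv : E3 →L[ℝ] E3).hasFDerivAt.comp_hasDerivAt _ hf
    have hs := hLd ((((hDa.mul_const (Real.cos (k * θ + φ))).smul_const (er θ)).add
      ((hDb.mul_const (Real.sin (k * θ + φ))).smul_const (eth θ))).add
      ((hDc.mul_const (Real.cos (k * θ + φ))).smul_const ez))
    have hθ := hLd ((((hang.cos.const_mul (a s)).smul (hasDerivAt_er θ)).add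
      ((hang.sin.const_mul (b s)).smul (hasDerivAt_eth θ))).add
      ((hang.cos.const_mul (c s)).smul_const ez))
    obtain ⟨e1, e2⟩ := fderiv_apply_eq_of_hasDerivAt (p := (s, θ))
      (hw.differentiable one_ne_zero _) hs hθ
    obtain ⟨hbd, hcd⟩ := hbc s hp
    have had : deriv a s = deriv γ s - k * deriv b s :=
      ((hγ.differentiable one_ne_zero s).hasDerivAt.sub (hDb.const_mul (k : ℝ))).deriv
    have hρs := hρg s hp
    have hgγ : g s * γ s = p₃ s := by
      change g s * (ρ s * p₃ s) = _
      linear_combination p₃ s * hρs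
    -- The shear equation; 1 - k² comes from k a + b = k γ + (1 - k²) b.
    have hgb : g s * deriv b s
        = 2 * p₂ s + deriv g s * (k * γ s + (1 - k ^ 2) * b s) + k * c s := by
      rw [hbd]
      linear_combination
        (2 * p₂ s + deriv g s * (k * γ s + (1 - k ^ 2) * b s) + k * c s) * hρs
    rw [e1, e2]
    simp only [tauS, tauT, LinearIsometryEquiv.inner_map_map, L]
    simp only [inner_add_left, inner_add_right, inner_smul_left, inner_smul_right, inner_neg_left,
      inner_er_er, inner_er_eth, inner_er_ez, inner_eth_er, inner_eth_eth, inner_eth_ez, inner_ez_er,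
      inner_ez_eth, inner_ez_ez, smul_neg]
    simp only [conj_trivial]
    refine ⟨?_, ?_, ?_⟩
    · rw [had]
      linear_combination Real.cos (k * θ + φ) * hcd
    · simp only [ha_def]
      linear_combination Real.sin (k * θ + φ) * hgb
    · simp only [ha_def]
      linear_combination Real.cos (k * θ + φ) * hgγ

/-! ### Density of the trigonometric fields -/

/-- Trigonometric polynomials in the angle with coefficients of class `C¹` in the axial variable. -/
def trigFields : Submodule ℝ (ℝ × ℝ → ℝ) :=
  Submodule.span ℝ {f | ∃ (q : ℝ → ℝ) (k : ℤ) (φ : ℝ), ContDiff ℝ 1 q ∧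
    f = fun p => q p.1 * Real.cos (k * p.2 + φ)}

theorem mode_mem_trigFields {q : ℝ → ℝ} (hq : ContDiff ℝ 1 q) (k : ℤ) (φ : ℝ) :
    (fun p : ℝ × ℝ => q p.1 * Real.cos (k * p.2 + φ)) ∈ trigFields :=
  Submodule.subset_span ⟨q, k, φ, hq, rfl⟩

/-- Product-to-sum formula. Closure under products is what Stone–Weierstrass needs. -/
theorem mul_mem_trigFields {f h : ℝ × ℝ → ℝ} (hf : f ∈ trigFields) (hh : h ∈ trigFields) :
    f * h ∈ trigFields := by
  have key := Submodule.mul_mem_mul hf hh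
  rw [trigFields, Submodule.span_mul_span] at key
  refine (Submodule.span_le.2 ?_) key
  rintro _ ⟨_, ⟨q, k, φ, hq, rfl⟩, _, ⟨q', k', φ', hq', rfl⟩, rfl⟩
  have h1 := mode_mem_trigFields (hq.mul hq') (k + k') (φ + φ')
  have h2 := mode_mem_trigFields (hq.mul hq') (k - k') (φ - φ')
  have h3 := trigFields.smul_mem (1 / 2 : ℝ) (trigFields.add_mem h1 h2)
  refine (congrArg (· ∈ trigFields) ?_).mpr h3
  ext p
  simp only [Pi.mul_apply, Pi.smul_apply, Pi.add_apply, smul_eq_mul, Int.cast_add, Int.cast_sub]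
  have e1 : ((k : ℝ) + k') * p.2 + (φ + φ') = (k * p.2 + φ) + (k' * p.2 + φ') := by ring
  have e2 : ((k : ℝ) - k') * p.2 + (φ - φ') = (k * p.2 + φ) - (k' * p.2 + φ') := by ring
  rw [e1, e2]
  generalize (k : ℝ) * p.2 + φ = a
  generalize (k' : ℝ) * p.2 + φ' = b
  rw [Real.cos_add, Real.cos_sub]
  ring

theorem const_mem_trigFields (c : ℝ) : (fun _ : ℝ × ℝ => c) ∈ trigFields := by
  simpa using mode_mem_trigFields (contDiff_const (c := c)) 0 0

theorem IsProfile.isStrain_of_mem_trigFields (hg : IsProfile s₀ s₁ g) {e₁ e₂ e₃ : ℝ × ℝ → ℝ}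
    (h₁ : e₁ ∈ trigFields) (h₂ : e₂ ∈ trigFields) (h₃ : e₃ ∈ trigFields) :
    IsStrain Φ s₀ s₁ g e₁ e₂ e₃ := by
  -- Strains form a linear space, so each of the three slots may be filled separately, one mode at a
  -- time.
  have key : ∀ ι : (ℝ × ℝ → ℝ) →ₗ[ℝ] (ℝ × ℝ → ℝ) × (ℝ × ℝ → ℝ) × (ℝ × ℝ → ℝ),
      (∀ (q : ℝ → ℝ) (k : ℤ) (φ : ℝ), ContDiff ℝ 1 q →
        IsStrain Φ s₀ s₁ g (ι fun p => q p.1 * Real.cos (k * p.2 + φ)).1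
          (ι fun p => q p.1 * Real.cos (k * p.2 + φ)).2.1
          (ι fun p => q p.1 * Real.cos (k * p.2 + φ)).2.2) →
      ∀ e ∈ trigFields, IsStrain Φ s₀ s₁ g (ι e).1 (ι e).2.1 (ι e).2.2 := by
    intro ι hι e he
    induction he using Submodule.span_induction with
    | mem e he =>
      obtain ⟨q, k, φ, hq, rfl⟩ := he
      exact hι q k φ hq
    | zero => simpa using isStrain_zero
    | add a b _ _ ha hb => simpa using ha.add hb
    | smul c a _ ha => simpa using ha.smul c
  have z : ContDiff ℝ 1 (fun _ : ℝ => (0 : ℝ)) := contDiff_const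
  have hz : (fun _ : ℝ × ℝ => (0 : ℝ)) = 0 := rfl
  have k₁ := key (LinearMap.inl ℝ _ _) (fun q k φ hq => by
    simpa [hz] using hg.isStrain_mode (Φ := Φ) hq z z k φ) e₁ h₁
  have k₂ := key (LinearMap.inr ℝ _ _ ∘ₗ LinearMap.inl ℝ _ _) (fun q k φ hq => by
    -- The shear slot of a mode carries a sine; a quarter-period shift of the phase turns it into
    -- the required cosine.
    have := hg.isStrain_mode (Φ := Φ) z hq z k (φ + Real.pi / 2)
    have h2 := this
    simp only [← add_assoc, Real.sin_add_pi_div_two] at h2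
    simpa [hz] using h2) e₂ h₂
  have k₃ := key (LinearMap.inr ℝ _ _ ∘ₗ LinearMap.inr ℝ _ _) (fun q k φ hq => by
    simpa [hz] using hg.isStrain_mode (Φ := Φ) z z hq k φ) e₃ h₃
  simpa using (k₁.add k₂).add k₃

/-- Continuous functions on space whose restriction to the surface is trigonometric. -/
def trigAlgebra (Φ : E3 ≃ᵃⁱ[ℝ] E3) (s₀ s₁ : ℝ) (g : ℝ → ℝ) : Subalgebra ℝ C(E3, ℝ) where
  carrier := {f | ∃ t ∈ trigFields, ∀ p : ℝ × ℝ, p.1 ∈ Icc s₀ s₁ → f (param Φ g p) = t p}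
  mul_mem' := by
    rintro f h ⟨t, ht, hft⟩ ⟨t', ht', hht⟩
    exact ⟨t * t', mul_mem_trigFields ht ht', fun p hp => by simp [hft p hp, hht p hp]⟩
  add_mem' := by
    rintro f h ⟨t, ht, hft⟩ ⟨t', ht', hht⟩
    exact ⟨t + t', trigFields.add_mem ht ht', fun p hp => by simp [hft p hp, hht p hp]⟩
  algebraMap_mem' c := ⟨fun _ => c, const_mem_trigFields c, fun p _ => by simp⟩

/-- The Cartesian coordinates, once Φ is undone, restrict to the modes g cos θ, g sin θ and s. -/
theorem IsProfile.separatesPoints_trigAlgebra (hg : IsProfile s₀ s₁ g) :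
    (trigAlgebra Φ s₀ s₁ g).SeparatesPoints := by
  intro x y hxy
  have hne : Φ.symm x ≠ Φ.symm y := fun h => hxy (Φ.symm.injective h)
  obtain ⟨i, hi⟩ : ∃ i, Φ.symm x i ≠ Φ.symm y i := by
    by_contra! h
    exact hne (by ext i; exact h i)
  let f : C(E3, ℝ) := ⟨fun x => Φ.symm x i,
    (EuclideanSpace.proj (𝕜 := ℝ) i).continuous.comp Φ.symm.continuous⟩
  refine ⟨f, ⟨f, ?_, rfl⟩, hi⟩
  fin_cases i
  · refine ⟨_, mode_mem_trigFields hg.contDiff 1 0, fun p _ => ?_⟩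
    simp [f, param, er, ez]
  · refine ⟨_, mode_mem_trigFields hg.contDiff 1 (-(Real.pi / 2)), fun p _ => ?_⟩
    simp [f, param, er, ez, ← sub_eq_add_neg, Real.cos_sub_pi_div_two]
  · refine ⟨_, mode_mem_trigFields contDiff_id 0 0, fun p _ => ?_⟩
    simp [f, param, er, ez]

/-- Trigonometric fields are dense in `L²` of the surface. -/
theorem IsProfile.exists_mem_trigFields_eLpNorm_sub_le (hg : IsProfile s₀ s₁ g) {f : E3 → ℝ}
    (hf : MemLp f 2 (area (surfaceOfRevolution Φ s₀ s₁ g))) {ε : ℝ≥0∞} (hε : ε ≠ 0) :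
    ∃ t ∈ trigFields, AEStronglyMeasurable (fun x => t (coords Φ x))
        (area (surfaceOfRevolution Φ s₀ s₁ g)) ∧
      eLpNorm (fun x => f x - t (coords Φ x)) 2 (area (surfaceOfRevolution Φ s₀ s₁ g)) ≤ ε := by
  have := hg.isFiniteMeasure_area (Φ := Φ)
  set S := surfaceOfRevolution Φ s₀ s₁ g
  have hε2 : ε / 2 ≠ 0 := by simpa using hε
  obtain ⟨h, hh, hhm⟩ := hf.exists_boundedContinuous_eLpNorm_sub_le (by norm_num) hε2
  -- A uniform error δ on S costs δ · area(S)^{1/2} in L². Half of ε pays for a bounded continuous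
  -- approximation of f, half for the Stone–Weierstrass step.
  obtain ⟨δ, hδ, hδle⟩ := ENNReal.exists_nnreal_pos_mul_lt
    (a := area S univ ^ (2 : ℝ≥0∞).toReal⁻¹) (by finiteness) hε2
  obtain ⟨P, ⟨t, ht, hPt⟩, hPn⟩ := ContinuousMap.exists_mem_subalgebra_near_continuous_of_isCompact_of_separatesPoints
    (hg.separatesPoints_trigAlgebra (Φ := Φ)) h.toContinuousMap hg.isCompact_surface (K := S)
    (ε := δ) hδ
  have hS : ∀ᵐ x ∂area S, P x = t (coords Φ x) ∧ ‖h x - P x‖ ≤ δ := by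
    filter_upwards [hg.ae_mem_surface] with x hx
    obtain ⟨h1, h2⟩ := hg.param_coords hx
    refine ⟨by rw [← hPt _ h2, h1], ?_⟩
    rw [norm_sub_rev]
    exact (hPn x hx).le
  have heq : (fun x => f x - t (coords Φ x)) =ᵐ[area S] (f - h) + fun x => h x - P x := by
    filter_upwards [hS] with x hx
    simp [hx.1]
  have hPm : AEStronglyMeasurable P (area S) := P.continuous.aestronglyMeasurable
  refine ⟨t, ht, hPm.congr (hS.mono fun x hx => hx.1), ?_⟩
  rw [eLpNorm_congr_ae heq]
  refine (eLpNorm_add_le (hf.1.sub hhm.1) (hhm.1.sub hPm) (by norm_num)).trans ?_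
  refine (add_le_add hh ((eLpNorm_le_of_ae_bound (hS.mono fun x hx => hx.2)).trans ?_)).trans_eq
    (ENNReal.add_halves ε)
  rw [ENNReal.ofReal_coe_nnreal, mul_comm]
  exact hδle.le

/-! ### The space of finite strains -/

theorem memLp_component {B : E3 → E3 →L[ℝ] E3}
    (hg : IsProfile s₀ s₁ g) (hB : MemLp B 2 (area (surfaceOfRevolution Φ s₀ s₁ g)))
    {τ η : ℝ × ℝ → E3} (hτ : Continuous τ) (hη : Continuous η) :
    MemLp (fun x => ⟪B x (τ (coords Φ x)), η (coords Φ x)⟫_ℝ) 2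
      (area (surfaceOfRevolution Φ s₀ s₁ g)) := by
  have hK : IsCompact (Icc s₀ s₁ ×ˢ Icc (-Real.pi) Real.pi) := isCompact_Icc.prod isCompact_Icc
  obtain ⟨C, hC⟩ := hK.exists_bound_of_continuousOn hτ.continuousOn
  obtain ⟨D, hD⟩ := hK.exists_bound_of_continuousOn hη.continuousOn
  have hmτ : AEStronglyMeasurable (fun x => τ (coords Φ x))
      (area (surfaceOfRevolution Φ s₀ s₁ g)) :=
    (hτ.stronglyMeasurable.comp_measurable measurable_coords).aestronglyMeasurable
  have hmη : AEStronglyMeasurable (fun x => η (coords Φ x))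
      (area (surfaceOfRevolution Φ s₀ s₁ g)) :=
    (hη.stronglyMeasurable.comp_measurable measurable_coords).aestronglyMeasurable
  have happ : Continuous fun q : (E3 →L[ℝ] E3) × E3 => q.1 q.2 := by fun_prop
  refine MemLp.of_le_mul (c := C * D) hB
    ((happ.comp_aestronglyMeasurable (hB.1.prodMk hmτ)).inner hmη) ?_
  filter_upwards [hg.ae_mem_surface] with x hx
  have hmem : coords Φ x ∈ Icc s₀ s₁ ×ˢ Icc (-Real.pi) Real.pi :=
    ⟨(hg.param_coords hx).2, (Complex.neg_pi_lt_arg _).le, Complex.arg_le_pi _⟩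
  have h1 := hC _ hmem
  have h2 := hD _ hmem
  calc ‖⟪B x (τ (coords Φ x)), η (coords Φ x)⟫_ℝ‖
      ≤ ‖B x (τ (coords Φ x))‖ * ‖η (coords Φ x)‖ := norm_inner_le_norm _ _
    _ ≤ (‖B x‖ * ‖τ (coords Φ x)‖) * ‖η (coords Φ x)‖ := by
        gcongr
        exact (B x).le_opNorm _
    _ ≤ (‖B x‖ * C) * D := by
        have := (norm_nonneg _).trans h1
        gcongr
    _ = C * D * ‖B x‖ := by ring

theorem finiteStrains_eq_closure (S : Set E3) : finiteStrains S = closure (strains S) := by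
  ext B
  exact mem_closure_iff_seq_limit.symm

/-- Every symmetric tangential field is a limit of strains. -/
theorem IsProfile.symTanFields_subset (hg : IsProfile s₀ s₁ g) :
    symTanFields (surfaceOfRevolution Φ s₀ s₁ g) ⊆
      closure (strains (surfaceOfRevolution Φ s₀ s₁ g)) := by
  set S := surfaceOfRevolution Φ s₀ s₁ g with hS
  intro B hB
  have hBm : MemLp B 2 (area S) := Lp.memLp B
  obtain ⟨m, hm, hmg⟩ := hg.exists_le_profile
  have hτS := hg.continuous_tauS (Φ := Φ)
  have hτT := hg.continuous_tauT (Φ := Φ)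
  have b₁ := memLp_component hg hBm hτS hτS
  have b₂ := memLp_component hg hBm hτS hτT
  have b₃ := memLp_component hg hBm hτT hτT
  rw [EMetric.mem_closure_iff]
  intro ε hε
  -- The factor (1 + 1/m)² comes from `IsProfile.norm_le_of_tangential`; the 4 counts the component
  -- errors, with the mixed one taken twice.
  obtain ⟨δ, hδ, hδle⟩ := ENNReal.exists_nnreal_pos_mul_lt
    (a := ENNReal.ofReal ((1 + m⁻¹) ^ 2) * 4) (by finiteness) hε.ne'
  have hδ0 : (δ : ℝ≥0∞) ≠ 0 := by simpa using hδ.ne'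
  obtain ⟨t₁, ht₁, hm₁, hn₁⟩ := hg.exists_mem_trigFields_eLpNorm_sub_le b₁ hδ0
  obtain ⟨t₂, ht₂, hm₂, hn₂⟩ := hg.exists_mem_trigFields_eLpNorm_sub_le b₂ hδ0
  obtain ⟨t₃, ht₃, hm₃, hn₃⟩ := hg.exists_mem_trigFields_eLpNorm_sub_le b₃ hδ0
  obtain ⟨W, G, hW, hG⟩ := (hg.isStrain_of_mem_trigFields (Φ := Φ) ht₁ ht₂ ht₃).exists_hasWeakGradient hg
  have hE := hg.memLp_symGrad hW.memLp_grad
  refine ⟨hE.toLp _, ⟨W, G, hW, hE.coeFn_toLp⟩, ?_⟩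
  set r₁ := fun x => ⟪B x (tauS Φ g (coords Φ x)), tauS Φ g (coords Φ x)⟫_ℝ - t₁ (coords Φ x)
  set r₂ := fun x => ⟪B x (tauS Φ g (coords Φ x)), tauT Φ g (coords Φ x)⟫_ℝ - t₂ (coords Φ x)
  set r₃ := fun x => ⟪B x (tauT Φ g (coords Φ x)), tauT Φ g (coords Φ x)⟫_ℝ - t₃ (coords Φ x)
  have hr₁ : AEStronglyMeasurable r₁ (area S) := b₁.1.sub hm₁
  have hr₂ : AEStronglyMeasurable r₂ (area S) := b₂.1.sub hm₂
  have hr₃ : AEStronglyMeasurable r₃ (area S) := b₃.1.sub hm₃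
  have hbound : ∀ᵐ x ∂area S, ‖(⇑B - ⇑(hE.toLp _)) x‖ ≤
      (1 + m⁻¹) ^ 2 * ‖(fun x => ‖r₁ x‖ + (‖r₂ x‖ + ‖r₂ x‖) + ‖r₃ x‖) x‖ := by
    filter_upwards [hB, hE.coeFn_toLp, hg.ae_mem_surface] with x hx hEx hxS
    obtain ⟨hp, hI⟩ := hg.param_coords hxS
    have hc := hG _ hI
    rw [hp] at hc
    rw [Pi.sub_apply, hEx]
    have key := hg.norm_le_of_tangential (Φ := Φ) hm hI (hmg _ hI) (M := B x - symGrad S G x)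
      (by
        rw [hp]
        have h1 := hx.1
        have h2 := tan_symGrad S G x
        rw [tan] at h1
        rw [ContinuousLinearMap.sub_comp, ContinuousLinearMap.comp_sub, h1, h2])
      (by rw [map_sub, hx.2, adjoint_symGrad])
    simp only [sub_apply, inner_sub_left] at key
    rw [hc.1, hc.2.1, hc.2.2] at key
    refine key.trans_eq ?_
    rw [Real.norm_of_nonneg (by positivity)]
    simp only [r₁, r₂, r₃, Real.norm_eq_abs]
    ring
  rw [Lp.edist_def]
  calc eLpNorm (⇑B - ⇑(hE.toLp _)) 2 (area S)
      ≤ ENNReal.ofReal ((1 + m⁻¹) ^ 2) *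
          eLpNorm (fun x => ‖r₁ x‖ + (‖r₂ x‖ + ‖r₂ x‖) + ‖r₃ x‖) 2 (area S) :=
        eLpNorm_le_mul_eLpNorm_of_ae_le_mul hbound 2
    _ ≤ ENNReal.ofReal ((1 + m⁻¹) ^ 2) * (δ + (δ + δ) + δ) := by
        gcongr
        refine (eLpNorm_add_le (hr₁.norm.add (hr₂.norm.add hr₂.norm)) hr₃.norm
          (by norm_num)).trans (add_le_add ((eLpNorm_add_le hr₁.norm (hr₂.norm.add hr₂.norm)
          (by norm_num)).trans (add_le_add ?_ ((eLpNorm_add_le hr₂.norm hr₂.norm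
          (by norm_num)).trans (add_le_add ?_ ?_)))) ?_)
        all_goals rwa [eLpNorm_norm]
    _ = δ * (ENNReal.ofReal ((1 + m⁻¹) ^ 2) * 4) := by ring
    _ < ε := hδle

theorem strains_subset_symTanFields (S : Set E3) : strains S ⊆ symTanFields S := by
  rintro E ⟨w, G, -, hE⟩
  filter_upwards [hE] with x hx
  rw [tan, hx]
  exact ⟨tan_symGrad S G x, adjoint_symGrad S G x⟩

/-- An L² limit is an almost everywhere limit along a subsequence, and both conditions are closed at
each point. -/
theorem isClosed_symTanFields (S : Set E3) : IsClosed (symTanFields S) := by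
  refine IsSeqClosed.isClosed fun E B hE hB => ?_
  obtain ⟨ns, -, hns⟩ := (tendstoInMeasure_of_tendsto_Lp hB).exists_seq_tendsto_ae
  filter_upwards [hns, ae_all_iff.2 fun n => hE (ns n)] with x hx hEx
  have hc : Continuous fun M : E3 →L[ℝ] E3 => tangentProj S x ∘L M ∘L tangentProj S x := by
    fun_prop
  constructor
  · refine tendsto_nhds_unique ((hc.tendsto _).comp hx) (hx.congr fun n => ?_)
    exact (hEx n).1.symm
  · refine tendsto_nhds_unique ((continuous_adjoint.tendsto _).comp hx) (hx.congr fun n => ?_)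
    exact (hEx n).2.symm

theorem IsProfile.finiteStrains_eq (hg : IsProfile s₀ s₁ g) :
    finiteStrains (surfaceOfRevolution Φ s₀ s₁ g) =
      symTanFields (surfaceOfRevolution Φ s₀ s₁ g) := by
  rw [finiteStrains_eq_closure]
  exact (closure_minimal (strains_subset_symTanFields _) (isClosed_symTanFields _)).antisymm
    hg.symTanFields_subset

/-- A ∈ L⁴ gives A² ∈ L², and Aᵀ = -A gives (A²)ᵀ = A²; the description of the finite strains does
the rest. -/
theorem IsProfile.approximatelyRobust (hg : IsProfile s₀ s₁ g) :
    ApproximatelyRobust (surfaceOfRevolution Φ s₀ s₁ g) := by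
  rintro V A - ⟨G, hA⟩ - hskew
  set S := surfaceOfRevolution Φ s₀ s₁ g with hS
  have hA4 := hg.memLp_four hA
  have hcomp : Continuous fun M : E3 →L[ℝ] E3 => M ∘L M := by fun_prop
  have hA2 : MemLp (fun x => A x ∘L A x) 2 (area S) := by
    have h : MemLp (fun x => ‖A x‖ ^ 2) 2 (area S) := by
      have h4 : MemLp (fun x => ‖A x‖ ^ (2 : ℝ≥0∞).toReal) (4 / 2) (area S) :=
        hA4.norm_rpow_div 2
      have h42 : (4 / 2 : ℝ≥0∞) = 2 :=
        ((ENNReal.eq_div_iff (by norm_num) (by norm_num)).2 (by norm_num)).symm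
      simpa [h42] using h4
    refine h.mono (hcomp.comp_aestronglyMeasurable hA.memLp.1) (ae_of_all _ fun x => ?_)
    rw [Real.norm_of_nonneg (by positivity), sq]
    exact ContinuousLinearMap.opNorm_comp_le _ _
  have ht := hg.memLp_tan hA2
  refine ⟨ht.toLp _, ?_, ht.coeFn_toLp⟩
  rw [hg.finiteStrains_eq]
  filter_upwards [ht.coeFn_toLp, hskew] with x hx hsk
  rw [tan, hx]
  refine ⟨tan_tan S _ x, ?_⟩
  rw [adjoint_tan, ContinuousLinearMap.adjoint_comp, hsk, tan]
  simp

/-! ### Normalization of the profile -/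

theorem surfaceOfRevolution_congr {g' : ℝ → ℝ} (h : ∀ s ∈ Icc s₀ s₁, g' s = g s) :
    surfaceOfRevolution Φ s₀ s₁ g' = surfaceOfRevolution Φ s₀ s₁ g := by
  ext x
  refine exists_congr fun s => and_congr_right fun hs => ?_
  rw [h s hs]

/-- A half-turn θ ↦ θ + π changes the sign of the radius. -/
theorem surfaceOfRevolution_neg :
    surfaceOfRevolution Φ s₀ s₁ (-g) = surfaceOfRevolution Φ s₀ s₁ g := by
  have key : ∀ f : ℝ → ℝ, surfaceOfRevolution Φ s₀ s₁ (-f) ⊆ surfaceOfRevolution Φ s₀ s₁ f := by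
    rintro f _ ⟨s, hs, θ, rfl⟩
    exact ⟨s, hs, θ + Real.pi, by simp⟩
  exact (key g).antisymm (by simpa using key (-g))

/-- Values of g off the interval are arbitrary, so g is replaced by a C¹ extension of its
restriction, which leaves the surface unchanged. -/
theorem exists_isProfile_of_pos (hs : s₀ < s₁) (hg : ContDiffOn ℝ 2 g (Icc s₀ s₁))
    (hpos : ∀ s ∈ Icc s₀ s₁, 0 < g s) :
    ∃ f, IsProfile s₀ s₁ f ∧
      surfaceOfRevolution Φ s₀ s₁ f = surfaceOfRevolution Φ s₀ s₁ g := by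
  have hu := uniqueDiffOn_Icc hs
  obtain ⟨f, hf, hfg⟩ := exists_contDiff_extension hs.le
    (fun t ht => ((hg.differentiableOn (by norm_num)) t ht).hasDerivWithinAt)
    (hg.continuousOn_derivWithin hu (by norm_num))
  refine ⟨f, ⟨hs, hf, ?_, fun s hs => ?_⟩, surfaceOfRevolution_congr fun s hs => (hfg s hs).1⟩
  · exact (hg.mono Ioo_subset_Icc_self).congr fun s hs => (hfg s (Ioo_subset_Icc_self hs)).1
  · rw [(hfg s hs).1]
    exact hpos s hs

/-- By the intermediate value theorem g has constant sign, and a negative profile generates the same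
surface as its opposite. -/
theorem exists_isProfile (hs : s₀ < s₁) (hg : ContDiffOn ℝ 2 g (Icc s₀ s₁))
    (hne : ∀ s ∈ Icc s₀ s₁, g s ≠ 0) :
    ∃ f, IsProfile s₀ s₁ f ∧
      surfaceOfRevolution Φ s₀ s₁ f = surfaceOfRevolution Φ s₀ s₁ g := by
  by_cases hpos : ∀ s ∈ Icc s₀ s₁, 0 < g s
  · exact exists_isProfile_of_pos hs hg hpos
  · push Not at hpos
    obtain ⟨a, ha, hga⟩ := hpos
    have hneg : ∀ s ∈ Icc s₀ s₁, 0 < (-g) s := by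
      intro b hb
      by_contra! hgb
      obtain ⟨c, hc, hc0⟩ := isPreconnected_Icc.intermediate_value ha hb hg.continuousOn
        (show (0 : ℝ) ∈ Icc (g a) (g b) from ⟨hga, by simpa using hgb⟩)
      exact hne c hc hc0
    obtain ⟨f, hf, hfg⟩ := exists_isProfile_of_pos (Φ := Φ) hs hg.neg hneg
    exact ⟨f, hf, hfg.trans surfaceOfRevolution_neg⟩

theorem ne_zero_of_disjoint_rotationAxis
    (h : Disjoint (closure (surfaceOfRevolution Φ s₀ s₁ g)) (rotationAxis Φ)) :
    ∀ s ∈ Icc s₀ s₁, g s ≠ 0 := by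
  intro s hs h0
  refine disjoint_left.1 h (subset_closure ⟨s, hs, 0, ?_⟩) ⟨s, rfl⟩
  simp [h0]

end Shell

end

theorem lemma5 (Φ : Shell.E3 ≃ᵃⁱ[ℝ] Shell.E3) (s₀ s₁ : ℝ) (hs : s₀ < s₁) (g : ℝ → ℝ)
    (hg : ContDiffOn ℝ 2 g (Set.Icc s₀ s₁))
    (haxis : Disjoint (closure (Shell.surfaceOfRevolution Φ s₀ s₁ g)) (Shell.rotationAxis Φ)) :
    Shell.finiteStrains (Shell.surfaceOfRevolution Φ s₀ s₁ g) =
        Shell.symTanFields (Shell.surfaceOfRevolution Φ s₀ s₁ g) ∧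
      Shell.ApproximatelyRobust (Shell.surfaceOfRevolution Φ s₀ s₁ g) := by
  obtain ⟨f, hf, hfg⟩ := Shell.exists_isProfile (Φ := Φ) hs hg
    (Shell.ne_zero_of_disjoint_rotationAxis haxis)
  rw [← hfg]
  exact ⟨hf.finiteStrains_eq, hf.approximatelyRobust⟩
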